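/- Let $f\colon\mathbb R\to(-1,1)$ be a $C^2$ bijection with $f'>0$ everywhere such that $\lim_{\phi\to-\infty}f''(\phi)/f'(\phi)$ exists and is a positive real number and $\lim_{\phi\to+\infty}f''(\phi)/f'(\phi)$ exists and is a negative real number. Let $V\colon\mathbb R\to\mathbb R$ be of class $C^2$ such that $V(\phi)>0$ for all sufficiently large $|\phi|$, $V'(\phi)<0$ for $\phi$ near $-\infty$, $V'(\phi)>0$ for $\phi$ near $+\infty$, and such that $$u(s)=\frac{V'(f^{-1}(s))}{\sqrt6\,V(f^{-1}(s))}$$ has finite limits as $s\to-1$ and as $s\to1$. Let $\delta>0$ be such that $V(f^{-1}(s))>0$ for $1-\delta\le|s|<1$ and $V'(f^{-1}(s))\neq0$ for $1-\delta<|s|<1$, and let $\psi\colon[-1,1]\to[0,1]$ be a smooth function with $\psi(s)=1$ for $|s|\le1-\delta$ and $\psi(s)=0$ for $1-\delta/2<|s|\le1$. Consider the system $$\frac{ds}{d\tau}=f'(f^{-1}(s))\,w,\qquad \frac{dx}{d\tau}=-\sqrt{\tfrac32}\,x\,w^2,\qquad \frac{dw}{d\tau}=(1-\psi(s))\,\theta_1(s,w)+\psi(s)\,\theta_2(s,x,w),$$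 where $$\theta_1(s,w)=\sqrt{\tfrac32}\,(w-u(s))(1-w^2),\qquad \theta_2(s,x,w)=\sqrt{\tfrac32}\,w(1-w^2)-\tfrac12V'(f^{-1}(s))\,x^2,$$ the term containing $\theta_1$ is $0$ where $\psi=1$, the term containing $\theta_2$ is $0$ where $\psi=0$, and the right-hand side is extended to $s=\pm1$ by continuity ($f'(f^{-1}(\pm1)):=0$, $u(\pm1):=\lim_{s\to\pm1}u(s)$). A collapsing scalar field in the flat case is a solution $(s,x,w)$ of this system with $s\in[-1,1]$ whose initial data at $\tau=0$ satisfy $s(0)\in(-1,1)$, $x(0)>0$ and $V(f^{-1}(s(0)))x(0)^2+w(0)^2=1$. Let $\bar x>0$ and $$\Omega=\{(s,x,w)\in\mathbb R^3:\ s\in(-1,1),\ x\in(0,\bar x],\ V(f^{-1}(s))x^2+w^2=1\},$$ $$M_0=\overline\Omega\cap\big(\{|s|=1\}\cup\{|w|=1\}\big)\cap\{x=0\}.$$ A property of initial data is said to hold generically in $\Omega$ if the set of points of $\Omega$ that have it is relatively open and dense in $\Omega$ (it persists under small perturbations of the initial data in $\Omega$, and every point of $\Omega$ acquires it after an arbitrarily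 small perturbation in $\Omega$). Then: 1. Every collapsing scalar field with initial data in $\Omega$, on any interval $[0,T)$, remains in $\Omega$. For every initial datum in $\Omega$ there is a collapsing scalar field defined for all $\tau\ge0$; it stays in $\Omega$ for all $\tau\ge0$, and every collapsing scalar field on an interval $[0,T)$ with the same initial datum coincides with it on $[0,T)$. 2. $M_0\subseteq\overline\Omega\setminus\Omega$, and generically in $\Omega$ the collapsing scalar field starting at the given point approaches $M_0$, that is, its distance from $M_0$ tends to $0$ as $\tau\to\infty$. 3. In particular, generically in $\Omega$, $\lim_{\tau\to\infty}x(\tau)=0^+$, that is, $x(\tau)\to0$ with $x(\tau)>0$. -/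

import Mathlib

open Set Filter Topology
open scoped ContDiff

noncomputable section

/-- A compactifying change of variable `s = f(φ)`: a `C²` increasing diffeomorphism of `ℝ` onto
`(-1, 1)` such that `f'' / f'` has a positive limit at `-∞` and a negative limit at `+∞`. -/
structure IsCompactification (f : ℝ → ℝ) : Prop where
  contDiff : ContDiff ℝ 2 f
  deriv_pos : ∀ φ, 0 < deriv f φ
  range_eq : range f = Ioo (-1) 1
  limit_bot : ∃ l : ℝ, 0 < l ∧ Tendsto (fun φ => deriv (deriv f) φ / deriv f φ) atBot (𝓝 l)
  limit_top : ∃ l : ℝ, l < 0 ∧ Tendsto (fun φ => deriv (deriv f) φ / deriv f φ) atTop (𝓝 l)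

/-- The value `φ = f⁻¹(s)` of the scalar field (only meaningful for `s` in the range of `f`). -/
def fieldOf (f : ℝ → ℝ) (s : ℝ) : ℝ := Function.invFun f s

/-- The function `u(s) = V'(f⁻¹(s)) / (√6 V(f⁻¹(s)))` on `(-1, 1)`. -/
def logSlope (V f : ℝ → ℝ) (s : ℝ) : ℝ :=
  deriv V (fieldOf f s) / (√6 * V (fieldOf f s))

/-- The standing assumption on the potential `V`. -/
structure AdmissiblePotential (V f : ℝ → ℝ) : Prop where
  contDiff : ContDiff ℝ 2 V
  pos_bot : ∀ᶠ φ in atBot, 0 < V φ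
  pos_top : ∀ᶠ φ in atTop, 0 < V φ
  deriv_neg_bot : ∀ᶠ φ in atBot, deriv V φ < 0
  deriv_pos_top : ∀ᶠ φ in atTop, 0 < deriv V φ
  limit_left : ∃ l : ℝ, Tendsto (logSlope V f) (𝓝[>] (-1)) (𝓝 l)
  limit_right : ∃ l : ℝ, Tendsto (logSlope V f) (𝓝[<] 1) (𝓝 l)

/-- A smooth cut-off `ψ : [-1, 1] → [0, 1]` equal to `1` for `|s| ≤ 1 - δ` and to `0` for
`|s| > 1 - δ / 2`, where `δ > 0` is such that `V > 0` and `V' ≠ 0` for `1 - δ < |s| < 1`. The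
inequality `V > 0` is also required at `|s| = 1 - δ`, so that `u` is defined on the support
of `1 - ψ`. -/
structure IsCutoff (V f : ℝ → ℝ) (δ : ℝ) (ψ : ℝ → ℝ) : Prop where
  delta_pos : 0 < δ
  potential_pos : ∀ s ∈ Ioo (-1 : ℝ) 1, 1 - δ ≤ |s| → 0 < V (fieldOf f s)
  deriv_ne_zero : ∀ s ∈ Ioo (-1 : ℝ) 1, 1 - δ < |s| → deriv V (fieldOf f s) ≠ 0
  smooth : ContDiffOn ℝ ∞ ψ (Icc (-1) 1)
  mem_Icc : ∀ s ∈ Icc (-1 : ℝ) 1, ψ s ∈ Icc (0 : ℝ) 1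
  eq_one : ∀ s ∈ Icc (-1 : ℝ) 1, |s| ≤ 1 - δ → ψ s = 1
  eq_zero : ∀ s ∈ Icc (-1 : ℝ) 1, 1 - δ / 2 < |s| → ψ s = 0

open Classical in
/-- `f'(f⁻¹(s))`, extended by `0` outside `(-1, 1)`. -/
def slopeExt (f : ℝ → ℝ) (s : ℝ) : ℝ :=
  if s ∈ Ioo (-1 : ℝ) 1 then deriv f (fieldOf f s) else 0

open Classical in
/-- The function `u`, extended to `s = ±1` by its limits there. -/
def logSlopeExt (V f : ℝ → ℝ) (s : ℝ) : ℝ :=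
  if s ∈ Ioo (-1 : ℝ) 1 then logSlope V f s else limUnder (𝓝[Ioo (-1) 1] s) (logSlope V f)

/-- `θ₁(s, w) = √(3/2) (w - u(s)) (1 - w²)`. -/
def theta1 (V f : ℝ → ℝ) (s w : ℝ) : ℝ :=
  √(3 / 2) * (w - logSlopeExt V f s) * (1 - w ^ 2)

/-- `θ₂(s, x, w) = √(3/2) w (1 - w²) - V'(f⁻¹(s)) x² / 2`. -/
def theta2 (V f : ℝ → ℝ) (s x w : ℝ) : ℝ :=
  √(3 / 2) * w * (1 - w ^ 2) - 1 / 2 * deriv V (fieldOf f s) * x ^ 2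

/-- The right-hand side of the system for `(s, x, w)`. Where `V` vanishes one has `ψ = 1`, so that
`theta1` does not contribute; at `s = ±1` one has `ψ = 0`, so that `theta2` does not contribute. -/
def flatField (V f ψ : ℝ → ℝ) (p : ℝ × ℝ × ℝ) : ℝ × ℝ × ℝ :=
  (slopeExt f p.1 * p.2.2,
    -√(3 / 2) * p.2.1 * p.2.2 ^ 2,
    (1 - ψ p.1) * theta1 V f p.1 p.2.2 + ψ p.1 * theta2 V f p.1 p.2.1 p.2.2)

/-- `γ = (s, x, w)` is a solution of the flat system (extended to `s = ±1`) on the time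
interval `I`. -/
def IsFlatSolution (V f ψ : ℝ → ℝ) (I : Set ℝ) (γ : ℝ → ℝ × ℝ × ℝ) : Prop :=
  ∀ τ ∈ I, (γ τ).1 ∈ Icc (-1 : ℝ) 1 ∧ HasDerivWithinAt γ (flatField V f ψ (γ τ)) I τ

/-- A collapsing scalar field in the flat case on the time interval `I`, which contains `0`: a
solution whose initial data satisfy `x(0) > 0` and the constraint `V x² + w² = 1`, the initial
value `s(0)` being an actual value of `f`. -/
structure IsFlatCollapse (V f ψ : ℝ → ℝ) (I : Set ℝ) (γ : ℝ → ℝ × ℝ × ℝ) : Prop where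
  solution : IsFlatSolution V f ψ I γ
  init_mem : (γ 0).1 ∈ Ioo (-1 : ℝ) 1
  init_pos : 0 < (γ 0).2.1
  init_constraint : V (fieldOf f (γ 0).1) * (γ 0).2.1 ^ 2 + (γ 0).2.2 ^ 2 = 1

/-- The set `Ω` of points `(s, x, w)` with `s ∈ (-1, 1)`, `x ∈ (0, x̄]` that satisfy the
constraint. -/
def Omega (V f : ℝ → ℝ) (xbar : ℝ) : Set (ℝ × ℝ × ℝ) :=
  {p | p.1 ∈ Ioo (-1 : ℝ) 1 ∧ p.2.1 ∈ Ioc 0 xbar ∧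
    V (fieldOf f p.1) * p.2.1 ^ 2 + p.2.2 ^ 2 = 1}

/-- `M₀ = closure Ω ∩ ({|s| = 1} ∪ {|w| = 1}) ∩ {x = 0}`. -/
def MZero (V f : ℝ → ℝ) (xbar : ℝ) : Set (ℝ × ℝ × ℝ) :=
  closure (Omega V f xbar) ∩ ({p | |p.1| = 1} ∪ {p | |p.2.2| = 1}) ∩ {p | p.2.1 = 0}

/-- The curve `γ` approaches the set `M` as `τ → ∞`: its distance from `M` tends to `0`. -/
def Approaches (γ : ℝ → ℝ × ℝ × ℝ) (M : Set (ℝ × ℝ × ℝ)) : Prop :=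
  ∀ ε > 0, ∃ T : ℝ, ∀ τ ≥ T, ∃ q ∈ M, dist (γ τ) q < ε

/-- The property `P` of initial data holds generically in `S`: it is stable under small
perturbations of the initial data in `S`, and any initial data in `S` acquire it after an
arbitrarily small perturbation in `S`. In other words, the data in `S` with the property form a
relatively open and dense subset of `S`. -/
def GenericallyIn (S : Set (ℝ × ℝ × ℝ)) (P : ℝ × ℝ × ℝ → Prop) : Prop :=
  (∃ U : Set (ℝ × ℝ × ℝ), IsOpen U ∧ {p ∈ S | P p} = S ∩ U) ∧ S ⊆ closure {p ∈ S | P p}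

end

/-! In the coordinate `φ = f⁻¹(s)` the constraint `V x² + w² = 1` makes `θ₁` and `θ₂` agree wherever
`ψ ≠ 1`, so on `Ω` the cut-off disappears and the system becomes `phaseField`, a `C¹` field. There
the constraint is invariant, `x` is positive and nonincreasing, and `w` is bounded because `V` is
bounded below. Since `φ` moves with bounded speed, solutions are global and `s = ±1` is not reached
in finite time.

Put `h = 1/x`, so `h' = √(3/2) h w²`. Either `x → 0`, or `h` converges to some `H`. In the second
case Barbalat's lemma gives `w → 0`, hence `V(φ) → H²`. A turning-point argument shows that `w`
eventually has constant sign, so `φ` converges in the extended reals, and `H²` is a critical value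
of `V` or a finite limit of `V` at `±∞` (`IsTrajectory.sq_mem_limitValues`).

These exceptional values form a bounded null set (the null part is Sard's theorem on the line).
Boundedness gives openness: once `h²` exceeds all of them, a condition stable under perturbation,
`x` must tend to `0` (`IsPotential.open_tendsto_x`).

Nullity gives density (`IsPotential.dense_tendsto_x`). If `h` stayed bounded for all data near a
point, Baire's theorem would provide an open set of data whose velocities share one sign from a
common time on. Flowing to that time, fixing `φ` and varying `x` gives a one-parameter family of
trajectories that are graphs of `h` over `φ`, with `dh/dφ = √(3/2) √(h² - V(φ))`. This slope
increases with `h`, so the gap between two graphs never shrinks and `H²` expands the parameter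
(`IsTrajectory.limit_expanding`). An interval would then be a Lipschitz image of a null set
(`IsPotential.not_forall_bounded`).

Finally, `Ω` lies in a compact box, and at a limit point with `x = 0` the constraint leaves only
`|s| = 1` or `|w| = 1`; hence approaching `M₀` is equivalent to `x → 0`. -/

/-! ### Autonomous equations: existence, uniqueness, continuous dependence -/

section AutonomousODE

variable {E : Type*} [NormedAddCommGroup E] [NormedSpace ℝ E]

/-- `z` is a solution of the autonomous equation `z' = F z` on the time interval `[0, T]`. -/
def SolvesOn (F : E → E) (T : ℝ) (z : ℝ → E) : Prop :=
  ∀ t ∈ Icc 0 T, HasDerivWithinAt z (F (z t)) (Icc 0 T) t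

theorem hasDerivWithinAt_Ici_of_Icc {z : ℝ → E} {z' : E} {a T t : ℝ} (ht : t ∈ Ico a T)
    (h : HasDerivWithinAt z z' (Icc a T) t) : HasDerivWithinAt z z' (Ici t) t := by
  refine h.mono_of_mem_nhdsWithin ?_
  filter_upwards [Icc_mem_nhdsGE ht.2] with s hs
  exact ⟨ht.1.trans hs.1, hs.2⟩

namespace SolvesOn

variable {F G : E → E} {T S : ℝ} {z y : ℝ → E}

theorem continuousOn (h : SolvesOn F T z) : ContinuousOn z (Icc 0 T) :=
  fun t ht => (h t ht).continuousWithinAt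

theorem mono (h : SolvesOn F T z) (hS : S ≤ T) : SolvesOn F S z := fun t ht =>
  (h t ⟨ht.1, ht.2.trans hS⟩).mono (Icc_subset_Icc_right hS)

theorem congr_field (h : SolvesOn F T z) (hFG : ∀ t ∈ Icc 0 T, F (z t) = G (z t)) :
    SolvesOn G T z := fun t ht => hFG t ht ▸ h t ht

theorem reverse (h : SolvesOn F T z) : SolvesOn (fun p => -F p) T (fun t => z (T - t)) := by
  intro t ht
  have hm : MapsTo (fun t => T - t) (Icc 0 T) (Icc 0 T) := fun s hs =>
    ⟨by linarith [hs.2], by linarith [hs.1]⟩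
  have h1 : HasDerivWithinAt (fun t : ℝ => T - t) (-1) (Icc 0 T) t := by
    simpa using (hasDerivWithinAt_id t _).const_sub T
  simpa [Function.comp_def] using HasDerivWithinAt.scomp t (h (T - t) (hm ht)) h1 hm

/-- The distance of two solutions of a Lipschitz equation grows at most exponentially. -/
theorem dist_le {K : NNReal} (hG : LipschitzWith K G) (hz : SolvesOn G T z) (hy : SolvesOn G T y) :
    ∀ t ∈ Icc 0 T, dist (z t) (y t) ≤ dist (z 0) (y 0) * Real.exp (K * t) := by
  intro t ht
  have := dist_le_of_trajectories_ODE (v := fun _ => G) (fun _ => hG) hz.continuousOn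
    (fun s hs => hasDerivWithinAt_Ici_of_Icc hs (hz s ⟨hs.1, hs.2.le⟩)) hy.continuousOn
    (fun s hs => hasDerivWithinAt_Ici_of_Icc hs (hy s ⟨hs.1, hs.2.le⟩)) le_rfl t ht
  simpa using this

theorem exists_norm_le (h : SolvesOn F T z) : ∃ R : ℝ, 0 < R ∧ ∀ t ∈ Icc 0 T, ‖z t‖ ≤ R := by
  obtain ⟨R, hR⟩ := isCompact_Icc.exists_bound_of_continuousOn h.continuousOn
  exact ⟨max R 1, by positivity, fun t ht => (hR t ht).trans (le_max_left _ _)⟩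

end SolvesOn

/-- A bounded Lipschitz autonomous equation has solutions on every time interval. -/
theorem exists_solvesOn_of_lipschitz [CompleteSpace E] {G : E → E} {K : NNReal} {M : ℝ}
    (hG : LipschitzWith K G) (hM : ∀ p, ‖G p‖ ≤ M) (p : E) {T : ℝ} (hT : 0 ≤ T) :
    ∃ z : ℝ → E, z 0 = p ∧ SolvesOn G T z := by
  have hM0 : 0 ≤ M := (norm_nonneg _).trans (hM p)
  -- The bound `M` holds on the whole space, so the ball may have radius `M T` and the solution
  -- exists on the full interval.
  have hpl : IsPicardLindelof (fun _ => G) (⟨0, le_rfl, hT⟩ : Icc 0 T) p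
      (⟨M, hM0⟩ * ⟨T, hT⟩) 0 ⟨M, hM0⟩ K := by
    refine IsPicardLindelof.of_time_independent (fun x _ => hM x) hG.lipschitzOnWith ?_
    simp only [sub_zero, sub_self, NNReal.coe_zero, max_eq_left hT]
    exact le_rfl
  obtain ⟨z, hz0, hz⟩ := hpl.exists_eq_forall_mem_Icc_hasDerivWithinAt₀
  exact ⟨z, hz0, hz⟩

variable [FiniteDimensional ℝ E]

/-- A `C¹` vector field coincides on any ball with a bounded Lipschitz one. -/
theorem exists_lipschitz_eq_on_ball {F : E → E} (hF : ContDiff ℝ 1 F) {R : ℝ} (hR : 0 < R) :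
    ∃ (G : E → E) (K : NNReal) (M : ℝ), LipschitzWith K G ∧ (∀ p, ‖G p‖ ≤ M) ∧
      ∀ p, ‖p‖ ≤ R → G p = F p := by
  let χ : ContDiffBump (0 : E) := ⟨R, R + 1, hR, by linarith⟩
  have hsupp : HasCompactSupport fun p => χ p • F p := χ.hasCompactSupport.smul_right
  have hdiff : ContDiff ℝ 1 fun p => χ p • F p := χ.contDiff.smul hF
  obtain ⟨K, hK⟩ := hdiff.lipschitzWith_of_hasCompactSupport hsupp one_ne_zero
  obtain ⟨M, hM⟩ := hsupp.exists_bound_of_continuous hdiff.continuous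
  refine ⟨_, K, M, hK, hM, fun p hp => ?_⟩
  have : χ p = 1 := χ.one_of_mem_closedBall (by simpa using hp)
  simp [this]

theorem SolvesOn.eqOn {F : E → E} (hF : ContDiff ℝ 1 F) {T : ℝ} {z y : ℝ → E}
    (hz : SolvesOn F T z) (hy : SolvesOn F T y) (h0 : z 0 = y 0) : EqOn z y (Icc 0 T) := by
  obtain ⟨R, hR, hzR⟩ := hz.exists_norm_le
  obtain ⟨R', -, hyR⟩ := hy.exists_norm_le
  obtain ⟨G, K, M, hK, -, hG⟩ := exists_lipschitz_eq_on_ball hF (lt_max_of_lt_left (c := R') hR)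
  intro t ht
  have := SolvesOn.dist_le hK
    (hz.congr_field fun t ht => (hG _ ((hzR t ht).trans (le_max_left _ _))).symm)
    (hy.congr_field fun t ht => (hG _ ((hyR t ht).trans (le_max_right _ _))).symm) t ht
  rw [h0, dist_self, zero_mul] at this
  exact dist_le_zero.1 this

/-- Solutions with initial data near that of a given solution on `[0, T]` exist on `[0, T]` and
remain close to the given one. -/
theorem SolvesOn.exists_near {F : E → E} (hF : ContDiff ℝ 1 F) {T : ℝ} (hT : 0 ≤ T) {z : ℝ → E}
    (hz : SolvesOn F T z) {ε : ℝ} (hε : 0 < ε) :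
    ∃ δ > 0, ∀ q, dist q (z 0) < δ →
      ∃ y, y 0 = q ∧ SolvesOn F T y ∧ ∀ t ∈ Icc 0 T, dist (y t) (z t) < ε := by
  have := FiniteDimensional.complete ℝ E
  obtain ⟨R, hR, hzR⟩ := hz.exists_norm_le
  -- The margin `ε` in the radius guarantees that a solution of `G` within `ε` of `z` stays where `G
  -- = F`.
  obtain ⟨G, K, M, hK, hM, hG⟩ := exists_lipschitz_eq_on_ball hF (add_pos hR hε)
  refine ⟨ε * Real.exp (-(K * T)), by positivity, fun q hq => ?_⟩
  obtain ⟨y, hy0, hy⟩ := exists_solvesOn_of_lipschitz hK hM q hT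
  have hclose : ∀ t ∈ Icc 0 T, dist (y t) (z t) < ε := by
    intro t ht
    refine (SolvesOn.dist_le hK hy (hz.congr_field fun t ht =>
      (hG _ ((hzR t ht).trans (by linarith))).symm) t ht).trans_lt ?_
    rw [hy0]
    calc dist q (z 0) * Real.exp (K * t) < ε * Real.exp (-(K * T)) * Real.exp (K * t) := by
          gcongr
      _ ≤ ε * Real.exp (-(K * T)) * Real.exp (K * T) := by
          gcongr; exact ht.2
      _ = ε := by rw [mul_assoc, ← Real.exp_add]; simp
  refine ⟨y, hy0, hy.congr_field fun t ht => hG _ ?_, hclose⟩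
  have h1 := hclose t ht
  rw [dist_eq_norm] at h1
  have h2 := hzR t ht
  have h3 := norm_add_le (y t - z t) (z t)
  rw [sub_add_cancel] at h3
  linarith

/-- A priori bounds give existence: if every solution starting at `p` on a subinterval of `[0, T]`
stays in the ball of radius `R`, there is a solution on `[0, T]`. -/
theorem exists_solvesOn_of_bound {F : E → E} (hF : ContDiff ℝ 1 F) {T : ℝ} (hT : 0 ≤ T) {p : E}
    {R : ℝ} (hb : ∀ S ∈ Icc 0 T, ∀ z, z 0 = p → SolvesOn F S z → ‖z S‖ < R) :
    ∃ z : ℝ → E, z 0 = p ∧ SolvesOn F T z := by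
  have := FiniteDimensional.complete ℝ E
  have hp : ‖p‖ < R := by
    suffices h : ‖p + (0 : ℝ) • F p‖ < R by simpa using h
    refine hb 0 ⟨le_rfl, hT⟩ (fun t => p + t • F p) (by simp) fun t ht => ?_
    have ht0 : t = 0 := le_antisymm ht.2 ht.1
    subst ht0
    simpa using (((hasDerivAt_id (0 : ℝ)).smul_const (F p)).const_add p).hasDerivWithinAt
  obtain ⟨G, K, M, hK, hM, hG⟩ := exists_lipschitz_eq_on_ball hF ((norm_nonneg p).trans_lt hp)
  obtain ⟨z, hz0, hz⟩ := exists_solvesOn_of_lipschitz hK hM p hT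
  refine ⟨z, hz0, ?_⟩
  suffices h : ∀ t ∈ Icc 0 T, ‖z t‖ ≤ R from hz.congr_field fun t ht => hG _ (h t ht)
  by_contra! hcon
  obtain ⟨t₁, ht₁, hzt₁⟩ := hcon
  have hclosed : IsClosed {t ∈ Icc 0 T | R ≤ ‖z t‖} :=
    hz.continuousOn.norm.preimage_isClosed_of_isClosed isClosed_Icc isClosed_Ici
  have hcpt : IsCompact {t ∈ Icc 0 T | R ≤ ‖z t‖} :=
    isCompact_Icc.of_isClosed_subset hclosed fun t ht => ht.1
  -- `S` is the first time the solution of the truncated equation reaches norm `R`. Up to `S` it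
  -- solves the true equation, so the a priori bound at `S` is contradicted.
  obtain ⟨S, ⟨hS, hzS⟩, hmin⟩ := hcpt.exists_isLeast ⟨t₁, ht₁, hzt₁.le⟩
  have hlt : ∀ t ∈ Ico 0 S, ‖z t‖ < R := fun t ht => by
    by_contra! h
    exact absurd (hmin ⟨⟨ht.1, ht.2.le.trans hS.2⟩, h⟩) (not_le.2 ht.2)
  have hle : ∀ t ∈ Icc 0 S, ‖z t‖ ≤ R := by
    have hS0 : (0 : ℝ) ≠ S := by rintro rfl; rw [hz0] at hzS; linarith
    rw [← closure_Ico hS0]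
    refine fun t ht => le_on_closure (f := fun t => ‖z t‖) (g := fun _ => R)
      (fun t ht => (hlt t ht).le) ?_ continuousOn_const ht
    rw [closure_Ico hS0]
    exact (hz.mono hS.2).continuousOn.norm
  have := hb S hS z hz0 ((hz.mono hS.2).congr_field fun t ht => hG _ (hle t ht))
  linarith

end AutonomousODE

/-! ### Linear scalar equations and gluing of solutions -/

/-- Two-sided exponential bounds for the square of a solution of a linear scalar equation. -/
theorem sq_bounds_of_linear {y a : ℝ → ℝ} {C T : ℝ}
    (hy : ∀ t ∈ Icc 0 T, HasDerivWithinAt y (a t * y t) (Icc 0 T) t)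
    (ha : ∀ t ∈ Icc 0 T, |a t| ≤ C) :
    ∀ t ∈ Icc 0 T, y 0 ^ 2 ≤ y t ^ 2 * Real.exp (2 * C * t) ∧
      y t ^ 2 * Real.exp (-(2 * C * t)) ≤ y 0 ^ 2 := by
  have key : ∀ k : ℝ, ∀ t ∈ Icc 0 T, HasDerivWithinAt (fun t => y t ^ 2 * Real.exp (k * t))
      ((2 * a t + k) * (y t ^ 2 * Real.exp (k * t))) (Icc 0 T) t := by
    intro k t ht
    have h1 := ((hy t ht).pow 2).mul
      (((hasDerivWithinAt_id t (Icc 0 T)).const_mul k).exp)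
    refine h1.congr_deriv ?_
    simp only [id, Pi.pow_apply]
    push_cast
    ring
  intro t ht
  have h0 : (0 : ℝ) ∈ Icc 0 T := ⟨le_rfl, ht.1.trans ht.2⟩
  have cont : ∀ k : ℝ, ContinuousOn (fun t => y t ^ 2 * Real.exp (k * t)) (Icc 0 T) :=
    fun k s hs => (key k s hs).continuousWithinAt
  have der : ∀ k : ℝ, ∀ s ∈ interior (Icc 0 T), HasDerivWithinAt
      (fun t => y t ^ 2 * Real.exp (k * t)) ((2 * a s + k) * (y s ^ 2 * Real.exp (k * s)))
      (interior (Icc 0 T)) s :=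
    fun k s hs => (key k s (interior_subset hs)).mono interior_subset
  constructor
  · have := monotoneOn_of_hasDerivWithinAt_nonneg (convex_Icc 0 T) (cont (2 * C)) (der (2 * C))
      (fun s hs => mul_nonneg (by linarith [abs_le.1 (ha s (interior_subset hs))])
        (by positivity)) h0 ht ht.1
    simpa using this
  · have := antitoneOn_of_hasDerivWithinAt_nonpos (convex_Icc 0 T) (cont (-(2 * C)))
      (der (-(2 * C))) (fun s hs => mul_nonpos_of_nonpos_of_nonneg
        (by linarith [abs_le.1 (ha s (interior_subset hs))]) (by positivity)) h0 ht ht.1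
    simpa using this

section Gluing

variable {E : Type*} [NormedAddCommGroup E] [NormedSpace ℝ E]

/-- `z` solves the autonomous equation `z' = F z` for all nonnegative times, the derivative at
time `0` being two-sided. -/
def SolvesForward (F : E → E) (z : ℝ → E) : Prop := ∀ t, 0 ≤ t → HasDerivAt z (F (z t)) t

theorem SolvesForward.solvesOn {F : E → E} {z : ℝ → E} (h : SolvesForward F z) (T : ℝ) :
    SolvesOn F T z := fun t ht => (h t ht.1).hasDerivWithinAt

theorem SolvesForward.shift {F : E → E} {z : ℝ → E} (h : SolvesForward F z) {a : ℝ}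
    (ha : 0 ≤ a) : SolvesForward F fun t => z (t + a) := fun t ht =>
  (h (t + a) (by positivity)).comp_add_const t a

variable [FiniteDimensional ℝ E]

/-- Solutions on all intervals `[0, T]` glue to a solution on `[0, ∞)`. -/
theorem exists_solvesForward {F : E → E} (hF : ContDiff ℝ 1 F) {p : E}
    (h : ∀ T : ℝ, 0 ≤ T → ∃ z : ℝ → E, z 0 = p ∧ SolvesOn F T z) :
    ∃ z : ℝ → E, z 0 = p ∧ SolvesForward F z := by
  choose Z hZ0 hZ using fun n : ℕ => h n n.cast_nonneg
  -- The affine continuation to negative times makes the derivative at `0` two-sided.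
  let z : ℝ → E := fun t => if 0 ≤ t then Z (⌊t⌋₊ + 1) t else p + t • F p
  have hzZ : ∀ (n : ℕ) (t : ℝ), 0 ≤ t → t < n → z t = Z n t := by
    intro n t ht htn
    have hle : ((⌊t⌋₊ + 1 : ℕ) : ℝ) ≤ n := by exact_mod_cast (Nat.floor_lt ht).2 htn
    simp only [z, if_pos ht]
    exact (hZ (⌊t⌋₊ + 1)).eqOn hF ((hZ n).mono hle) (by rw [hZ0, hZ0])
      ⟨ht, by push_cast; exact (Nat.lt_floor_add_one t).le⟩
  have hz0 : z 0 = p := by rw [hzZ 1 0 le_rfl (by simp), hZ0]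
  have hright : ∀ t, 0 ≤ t → HasDerivWithinAt z (F (z t)) (Ici 0) t := by
    intro t ht
    set n := ⌊t⌋₊ + 1 with hn
    have htn : t < n := by rw [hn]; push_cast; exact Nat.lt_floor_add_one t
    have hmem : Ico 0 (n : ℝ) ∈ 𝓝[Ici 0] t := by
      filter_upwards [self_mem_nhdsWithin, nhdsWithin_le_nhds (Iio_mem_nhds htn)] with s h1 h2
      exact ⟨h1, h2⟩
    rw [hzZ n t ht htn]
    refine HasDerivWithinAt.congr_of_eventuallyEq (f := Z n) ?_ ?_ (hzZ n t ht htn)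
    · exact (hZ n t ⟨ht, htn.le⟩).mono_of_mem_nhdsWithin
        (mem_of_superset hmem Ico_subset_Icc_self)
    · filter_upwards [hmem] with s hs using hzZ n s hs.1 hs.2
  refine ⟨z, hz0, fun t ht => ?_⟩
  rcases ht.eq_or_lt with rfl | hlt
  · have hleft : HasDerivWithinAt z (F (z 0)) (Iic 0) 0 := by
      have h1 : HasDerivWithinAt (fun t : ℝ => p + t • F p) (F p) (Iic 0) 0 := by
        simpa using (((hasDerivAt_id (0 : ℝ)).smul_const (F p)).const_add p).hasDerivWithinAt
      rw [hz0]
      refine h1.congr_of_mem (fun s hs => ?_) self_mem_Iic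
      rcases (show s ≤ 0 from hs).eq_or_lt with rfl | hs
      · simp [hz0]
      · simp [z, not_le.2 hs]
    simpa using (hleft.union (hright 0 le_rfl))
  · exact (hright t ht).hasDerivAt (Ici_mem_nhds hlt)

end Gluing

theorem hasDerivWithinAt_triple_iff {z : ℝ → ℝ × ℝ × ℝ} {a b c t : ℝ} {S : Set ℝ} :
    HasDerivWithinAt z (a, b, c) S t ↔ HasDerivWithinAt (fun t => (z t).1) a S t ∧
      HasDerivWithinAt (fun t => (z t).2.1) b S t ∧
      HasDerivWithinAt (fun t => (z t).2.2) c S t := by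
  refine ⟨fun h => ?_, fun h => h.1.prodMk (h.2.1.prodMk h.2.2)⟩
  have h1 := (ContinuousLinearMap.fst ℝ ℝ (ℝ × ℝ)).hasFDerivAt.comp_hasDerivWithinAt t h
  have h2 := (ContinuousLinearMap.snd ℝ ℝ (ℝ × ℝ)).hasFDerivAt.comp_hasDerivWithinAt t h
  have h3 := (ContinuousLinearMap.fst ℝ ℝ ℝ).hasFDerivAt.comp_hasDerivWithinAt t h2
  have h4 := (ContinuousLinearMap.snd ℝ ℝ ℝ).hasFDerivAt.comp_hasDerivWithinAt t h2
  exact ⟨h1, h3, h4⟩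

/-! ### The system in phase coordinates -/

/-- The vector field of the flat system in the phase coordinates `(φ, x, w)`. -/
noncomputable def phaseField (V : ℝ → ℝ) (p : ℝ × ℝ × ℝ) : ℝ × ℝ × ℝ :=
  (p.2.2, -√(3 / 2) * p.2.1 * p.2.2 ^ 2,
    √(3 / 2) * p.2.2 * (1 - p.2.2 ^ 2) - 1 / 2 * deriv V p.1 * p.2.1 ^ 2)

/-- The set of states `(φ, x, w)` with `0 < x ≤ xbar` satisfying the constraint. -/
def phaseSet (V : ℝ → ℝ) (xbar : ℝ) : Set (ℝ × ℝ × ℝ) :=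
  {p | p.2.1 ∈ Ioc 0 xbar ∧ V p.1 * p.2.1 ^ 2 + p.2.2 ^ 2 = 1}

/-- The conditions on a `C²` potential used in the analysis in phase coordinates. -/
structure IsPotential (V : ℝ → ℝ) : Prop where
  contDiff : ContDiff ℝ 2 V
  bot : ∀ᶠ φ in atBot, 0 < V φ ∧ deriv V φ < 0
  top : ∀ᶠ φ in atTop, 0 < V φ ∧ 0 < deriv V φ
  slope : ∃ K : ℝ, ∀ᶠ φ in atBot ⊔ atTop, |deriv V φ| ≤ K * V φ

namespace IsPotential

variable {V : ℝ → ℝ}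

theorem continuous (hV : IsPotential V) : Continuous V := hV.contDiff.continuous

theorem hasDerivAt (hV : IsPotential V) (φ : ℝ) : HasDerivAt V (deriv V φ) φ :=
  (hV.contDiff.differentiable two_ne_zero φ).hasDerivAt

theorem contDiff_deriv (hV : IsPotential V) : ContDiff ℝ 1 (deriv V) :=
  ((contDiff_succ_iff_deriv (n := 1)).1 hV.contDiff).2.2

theorem exists_pos_outside (hV : IsPotential V) :
    ∃ R > 0, (∀ φ ≤ -R, 0 < V φ ∧ deriv V φ < 0) ∧ ∀ φ ≥ R, 0 < V φ ∧ 0 < deriv V φ := by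
  obtain ⟨a, ha⟩ := eventually_atBot.1 hV.bot
  obtain ⟨b, hb⟩ := eventually_atTop.1 hV.top
  have h1 := le_max_left |a| |b|
  have h2 := le_max_right |a| |b|
  refine ⟨max |a| |b| + 1, by positivity, fun φ h => ha φ ?_, fun φ h => hb φ ?_⟩
  · linarith [neg_abs_le a]
  · linarith [le_abs_self b]

theorem exists_lower_bound (hV : IsPotential V) : ∃ C ≥ 0, ∀ φ, -C ≤ V φ := by
  obtain ⟨R, hR, hbot, htop⟩ := hV.exists_pos_outside
  obtain ⟨C, hC⟩ := (isCompact_Icc (a := -R) (b := R)).exists_bound_of_continuousOn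
    hV.continuous.continuousOn
  refine ⟨max C 0, le_max_right _ _, fun φ => ?_⟩
  rcases le_total φ (-R) with h | h
  · linarith [(hbot φ h).1, le_max_right C 0]
  rcases le_total R φ with h' | h'
  · linarith [(htop φ h').1, le_max_right C 0]
  · linarith [neg_abs_le (V φ), hC φ ⟨h, h'⟩, le_max_left C 0, Real.norm_eq_abs (V φ)]

theorem contDiff_phaseField (hV : IsPotential V) : ContDiff ℝ 1 (phaseField V) := by
  have h : ContDiff ℝ 1 fun p : ℝ × ℝ × ℝ => deriv V p.1 := hV.contDiff_deriv.comp contDiff_fst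
  unfold phaseField
  fun_prop

/-- The velocity `w` is uniformly bounded on the constraint set. -/
theorem exists_velocity_bound (hV : IsPotential V) (xbar : ℝ) :
    ∃ W > 0, ∀ p ∈ phaseSet V xbar, |p.2.2| ≤ W := by
  obtain ⟨C, hC, hCV⟩ := hV.exists_lower_bound
  -- `w² = 1 - V x² ≤ 1 + C x̄²` when `V ≥ -C`.
  refine ⟨√(1 + C * xbar ^ 2), by positivity, fun p hp => Real.abs_le_sqrt ?_⟩
  have h1 : p.2.1 ^ 2 ≤ xbar ^ 2 := pow_le_pow_left₀ hp.1.1.le hp.1.2 2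
  nlinarith [hp.2, hCV p.1, mul_le_mul_of_nonneg_left h1 hC,
    mul_nonneg (by linarith [hCV p.1] : 0 ≤ V p.1 + C) (sq_nonneg p.2.1)]

end IsPotential

theorem solvesOn_phaseField_iff {V : ℝ → ℝ} {T : ℝ} {z : ℝ → ℝ × ℝ × ℝ} :
    SolvesOn (phaseField V) T z ↔ ∀ t ∈ Icc 0 T,
      HasDerivWithinAt (fun t => (z t).1) (z t).2.2 (Icc 0 T) t ∧
      HasDerivWithinAt (fun t => (z t).2.1) (-√(3 / 2) * (z t).2.1 * (z t).2.2 ^ 2) (Icc 0 T) t ∧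
      HasDerivWithinAt (fun t => (z t).2.2) (√(3 / 2) * (z t).2.2 * (1 - (z t).2.2 ^ 2)
        - 1 / 2 * deriv V (z t).1 * (z t).2.1 ^ 2) (Icc 0 T) t :=
  forall₂_congr fun _ _ => hasDerivWithinAt_triple_iff

/-- A solution of `y' = a y` with `a` continuous that vanishes somewhere vanishes everywhere. -/
theorem eq_zero_iff_of_linear {y a : ℝ → ℝ} {T : ℝ}
    (hy : ∀ t ∈ Icc 0 T, HasDerivWithinAt y (a t * y t) (Icc 0 T) t)
    (ha : ContinuousOn a (Icc 0 T)) : ∀ t ∈ Icc 0 T, y t = 0 ↔ y 0 = 0 := by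
  obtain ⟨C, hC⟩ := isCompact_Icc.exists_bound_of_continuousOn ha
  intro t ht
  obtain ⟨h1, h2⟩ := sq_bounds_of_linear hy hC t ht
  constructor
  · intro h
    rw [h] at h1
    exact pow_eq_zero_iff two_ne_zero |>.1 (le_antisymm (by simpa using h1) (sq_nonneg _))
  · intro h
    rw [h] at h2
    have : y t ^ 2 ≤ 0 := nonpos_of_mul_nonpos_left (by simpa using h2) (Real.exp_pos _)
    exact pow_eq_zero_iff two_ne_zero |>.1 (le_antisymm this (sq_nonneg _))

/-- A solution of `x' = a x` that is positive initially remains positive. -/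
theorem pos_of_linear {x a : ℝ → ℝ} {T : ℝ}
    (hx : ∀ t ∈ Icc 0 T, HasDerivWithinAt x (a t * x t) (Icc 0 T) t)
    (ha : ContinuousOn a (Icc 0 T)) (h0 : 0 < x 0) : ∀ t ∈ Icc 0 T, 0 < x t := by
  intro t ht
  have hne : ∀ s ∈ Icc 0 T, x s ≠ 0 := fun s hs h =>
    h0.ne' ((eq_zero_iff_of_linear hx ha s hs).1 h)
  by_contra! hle
  have hcont : ContinuousOn x (Icc 0 t) := fun s hs =>
    ((hx s ⟨hs.1, hs.2.trans ht.2⟩).continuousWithinAt).mono (Icc_subset_Icc_right ht.2)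
  obtain ⟨s, hs, hs0⟩ := intermediate_value_Icc' ht.1 hcont ⟨hle, h0.le⟩
  exact hne s ⟨hs.1, hs.2.trans ht.2⟩ hs0

namespace SolvesOn

variable {V : ℝ → ℝ} {T xbar : ℝ} {z : ℝ → ℝ × ℝ × ℝ}

/-- The defect `y = V x² + w² - 1` obeys `y' = -2√(3/2) w² y`. The equivalence, rather than one
implication, lets the constraint be carried backwards in time as well. -/
theorem constraint_iff (hV : IsPotential V) (hz : SolvesOn (phaseField V) T z) :
    ∀ t ∈ Icc 0 T, V (z t).1 * (z t).2.1 ^ 2 + (z t).2.2 ^ 2 = 1 ↔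
      V (z 0).1 * (z 0).2.1 ^ 2 + (z 0).2.2 ^ 2 = 1 := by
  have h := solvesOn_phaseField_iff.1 hz
  have hw : ContinuousOn (fun t => (z t).2.2) (Icc 0 T) := fun t ht =>
    (h t ht).2.2.continuousWithinAt
  have key := eq_zero_iff_of_linear (T := T)
    (y := fun t => V (z t).1 * (z t).2.1 ^ 2 + (z t).2.2 ^ 2 - 1)
    (a := fun t => -2 * √(3 / 2) * (z t).2.2 ^ 2) ?_ (by fun_prop)
  · simpa only [sub_eq_zero] using key
  intro t ht
  obtain ⟨h1, h2, h3⟩ := h t ht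
  refine (((((hV.hasDerivAt _).comp_hasDerivWithinAt t h1).mul (h2.pow 2)).add
    (h3.pow 2)).sub_const 1).congr_deriv ?_
  simp only [Function.comp_apply, Pi.pow_apply]
  push_cast
  ring

theorem pos_x (hz : SolvesOn (phaseField V) T z) (h0 : 0 < (z 0).2.1) :
    ∀ t ∈ Icc 0 T, 0 < (z t).2.1 := by
  have h := solvesOn_phaseField_iff.1 hz
  have hw : ContinuousOn (fun t => (z t).2.2) (Icc 0 T) := fun t ht =>
    (h t ht).2.2.continuousWithinAt
  refine pos_of_linear (a := fun t => -√(3 / 2) * (z t).2.2 ^ 2)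
    (fun t ht => ((h t ht).2.1).congr_deriv (by ring)) (by fun_prop) h0

theorem antitoneOn_x (hz : SolvesOn (phaseField V) T z) (h0 : 0 < (z 0).2.1) :
    AntitoneOn (fun t => (z t).2.1) (Icc 0 T) := by
  have h := solvesOn_phaseField_iff.1 hz
  refine antitoneOn_of_hasDerivWithinAt_nonpos (convex_Icc 0 T)
    (fun t ht => (h t ht).2.1.continuousWithinAt)
    (fun t ht => ((h t (interior_subset ht)).2.1).mono interior_subset) fun t ht => ?_
  have := pos_x hz h0 t (interior_subset ht)
  have : 0 ≤ √(3 / 2) * (z t).2.1 * (z t).2.2 ^ 2 := by positivity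
  linarith

theorem mem_phaseSet (hV : IsPotential V) (hz : SolvesOn (phaseField V) T z)
    (h0 : z 0 ∈ phaseSet V xbar) : ∀ t ∈ Icc 0 T, z t ∈ phaseSet V xbar := fun t ht =>
  ⟨⟨pos_x hz h0.1.1 t ht,
    (antitoneOn_x hz h0.1.1 ⟨le_rfl, ht.1.trans ht.2⟩ ht ht.1).trans h0.1.2⟩,
    (constraint_iff hV hz t ht).2 h0.2⟩

end SolvesOn

/-- The system in phase coordinates has global forward solutions on the constraint set. -/
theorem IsPotential.exists_forward {V : ℝ → ℝ} (hV : IsPotential V) {xbar : ℝ} {p : ℝ × ℝ × ℝ}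
    (hp : p ∈ phaseSet V xbar) :
    ∃ z : ℝ → ℝ × ℝ × ℝ, z 0 = p ∧ SolvesForward (phaseField V) z ∧
      ∀ t, 0 ≤ t → z t ∈ phaseSet V xbar := by
  obtain ⟨W, hW, hWb⟩ := hV.exists_velocity_bound xbar
  suffices h : ∃ z : ℝ → ℝ × ℝ × ℝ, z 0 = p ∧ SolvesForward (phaseField V) z by
    obtain ⟨z, h0, hz⟩ := h
    exact ⟨z, h0, hz, fun t ht => (hz.solvesOn t).mem_phaseSet hV (h0 ▸ hp) t ⟨ht, le_rfl⟩⟩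
  refine exists_solvesForward hV.contDiff_phaseField fun T hT =>
    exists_solvesOn_of_bound hV.contDiff_phaseField hT
      (R := |p.1| + W * T + xbar + W + 1) fun S hS z h0 hz => ?_
  have hmem := hz.mem_phaseSet hV (h0 ▸ hp)
  have hSS : S ∈ Icc 0 S := ⟨hS.1, le_rfl⟩
  have hφ : ‖(z S).1 - (z 0).1‖ ≤ W * ‖S - 0‖ :=
    (convex_Icc 0 S).norm_image_sub_le_of_norm_hasDerivWithin_le (f := fun t => (z t).1)
      (fun t ht => (solvesOn_phaseField_iff.1 hz t ht).1) (fun t ht => hWb _ (hmem t ht))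
      ⟨le_rfl, hS.1⟩ hSS
  rw [h0, Real.norm_eq_abs, Real.norm_eq_abs, sub_zero, abs_of_nonneg hS.1] at hφ
  have h1 : W * S ≤ W * T := by gcongr; exact hS.2
  have h2 := (hmem S hSS).1
  have h3 := hWb _ (hmem S hSS)
  have h4 := abs_sub_abs_le_abs_sub (z S).1 p.1
  have h5 : 0 ≤ W * T := by positivity
  have h6 := abs_nonneg p.1
  have h7 := h2.1.trans_le h2.2
  refine max_lt ?_ (max_lt ?_ ?_)
  · rw [Real.norm_eq_abs]; linarith
  · rw [Real.norm_eq_abs, abs_of_pos h2.1]; linarith [h2.2]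
  · rw [Real.norm_eq_abs]; linarith

/-- Forward solutions depend continuously on the initial data. -/
theorem IsPotential.forward_near {V : ℝ → ℝ} (hV : IsPotential V) {z : ℝ → ℝ × ℝ × ℝ}
    (hz : SolvesForward (phaseField V) z) {T : ℝ} (hT : 0 ≤ T) {ε : ℝ} (hε : 0 < ε) :
    ∃ δ > 0, ∀ y, SolvesForward (phaseField V) y → dist (y 0) (z 0) < δ →
      dist (y T) (z T) < ε := by
  obtain ⟨δ, hδ, h⟩ := (hz.solvesOn T).exists_near hV.contDiff_phaseField hT hε
  refine ⟨δ, hδ, fun y hy hd => ?_⟩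
  obtain ⟨y', h0, hy', hc⟩ := h _ hd
  have hTT : T ∈ Icc 0 T := ⟨hT, le_rfl⟩
  rw [(hy.solvesOn T).eqOn hV.contDiff_phaseField hy' h0.symm hTT]
  exact hc T hTT

/-- The time `T` map on the constraint set is open at interior points (with respect to the
constraint `x ≤ xbar`). -/
theorem IsPotential.backward_near {V : ℝ → ℝ} (hV : IsPotential V) {z : ℝ → ℝ × ℝ × ℝ}
    (hz : SolvesForward (phaseField V) z) {xbar : ℝ} (hx : (z 0).2.1 ∈ Ioo 0 xbar)
    {T : ℝ} (hT : 0 ≤ T) {ε : ℝ} (hε : 0 < ε) :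
    ∃ δ > 0, ∀ q ∈ phaseSet V xbar, dist q (z T) < δ →
      ∃ y, y 0 ∈ phaseSet V xbar ∧ SolvesForward (phaseField V) y ∧ dist (y 0) (z 0) < ε ∧
        y T = q := by
  have hrev : ContDiff ℝ 1 fun p => -phaseField V p := hV.contDiff_phaseField.neg
  -- Backwards in time `x` grows, so closeness to an `x` strictly between `0` and `xbar` is needed
  -- to land in `phaseSet`.
  have hε' : 0 < min ε (min (z 0).2.1 (xbar - (z 0).2.1)) :=
    lt_min hε (lt_min hx.1 (sub_pos.2 hx.2))
  obtain ⟨δ, hδ, h⟩ := (hz.solvesOn T).reverse.exists_near hrev hT hε'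
  refine ⟨δ, hδ, fun q hq hd => ?_⟩
  obtain ⟨y', h0, hy', hc⟩ := h q (by simpa using hd)
  have hy'' : SolvesOn (phaseField V) T fun t => y' (T - t) := by simpa using hy'.reverse
  have hTT : T ∈ Icc 0 T := ⟨hT, le_rfl⟩
  have hd0 := hc T hTT
  simp only [sub_self] at hd0
  have hdx : dist (y' T).2.1 (z 0).2.1 < min ε (min (z 0).2.1 (xbar - (z 0).2.1)) :=
    ((le_max_left _ _).trans (le_max_right _ _)).trans_lt hd0
  rw [Real.dist_eq, lt_min_iff, lt_min_iff, abs_lt, abs_lt] at hdx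
  have hmem : y' T ∈ phaseSet V xbar := by
    refine ⟨⟨by linarith [hdx.2.1.1], by linarith [(abs_lt.1 hdx.2.2).2]⟩, ?_⟩
    have := (hy''.constraint_iff hV T hTT)
    simp only [sub_self, sub_zero, h0] at this
    exact this.1 hq.2
  obtain ⟨y, hy0, hy, -⟩ := hV.exists_forward hmem
  refine ⟨y, hy0 ▸ hmem, hy, hy0 ▸ hd0.trans_le (min_le_left _ _), ?_⟩
  have := (hy.solvesOn T).eqOn hV.contDiff_phaseField hy'' (by simp [hy0]) hTT
  simpa [h0] using this

/-! ### Behaviour at infinity of a convergent function and its derivative -/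

theorem HasDerivAt.eventually_nhdsGT_lt {f : ℝ → ℝ} {f' a : ℝ} (h : HasDerivAt f f' a)
    (hf' : 0 < f') : ∀ᶠ t in 𝓝[>] a, f a < f t := by
  have h1 := (hasDerivAt_iff_tendsto_slope.1 h).eventually (lt_mem_nhds hf')
  filter_upwards [nhdsGT_le_nhdsNE a h1, self_mem_nhdsWithin] with t ht hta
  exact (slope_pos_iff_of_le (le_of_lt hta)).1 ht

theorem HasDerivAt.eventually_nhdsLT_lt {f : ℝ → ℝ} {f' a : ℝ} (h : HasDerivAt f f' a)
    (hf' : 0 < f') : ∀ᶠ t in 𝓝[<] a, f t < f a := by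
  have h1 := (hasDerivAt_iff_tendsto_slope.1 h).eventually (lt_mem_nhds hf')
  filter_upwards [nhdsLT_le_nhdsNE a h1, self_mem_nhdsWithin] with t ht hta
  rw [slope_comm] at ht
  exact (slope_pos_iff_of_le (le_of_lt hta)).1 ht

/-- Barbalat's lemma: if `L` converges and its derivative is Lipschitz, the derivative tends
to `0`. -/
theorem tendsto_zero_of_tendsto_of_lipschitz {L g : ℝ → ℝ} {l M : ℝ}
    (hL : ∀ t, 0 ≤ t → HasDerivAt L (g t) t) (hM : 0 < M)
    (hg : ∀ s t, 0 ≤ s → s ≤ t → |g t - g s| ≤ M * (t - s)) (hl : Tendsto L atTop (𝓝 l)) :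
    Tendsto g atTop (𝓝 0) := by
  rw [Metric.tendsto_nhds]
  intro ε hε
  -- On an interval of this length `g` varies by at most `ε / 2`. The mean value theorem yields a
  -- point there where `g` is below `ε / 2`.
  have hη : 0 < ε / (2 * M) := by positivity
  have h1 : Tendsto (fun t => L (t + ε / (2 * M)) - L t) atTop (𝓝 0) := by
    simpa using (hl.comp (tendsto_atTop_add_const_right _ _ tendsto_id)).sub hl
  have hpos : 0 < ε / (2 * M) * (ε / 2) := by positivity
  filter_upwards [(Metric.tendsto_nhds.1 h1) _ hpos, eventually_ge_atTop 0] with t ht ht0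
  obtain ⟨ξ, hξ, hξ'⟩ := exists_hasDerivAt_eq_slope L g (lt_add_of_pos_right t hη)
    (fun s hs => (hL s (ht0.trans hs.1)).continuousAt.continuousWithinAt)
    (fun s hs => hL s (ht0.trans hs.1.le))
  rw [add_sub_cancel_left, eq_div_iff hη.ne'] at hξ'
  rw [Real.dist_eq, sub_zero] at ht ⊢
  rw [← hξ', abs_mul, abs_of_pos hη, mul_comm] at ht
  have h2 := lt_of_mul_lt_mul_left ht hη.le
  have h3 := hg t ξ ht0 hξ.1.le
  have h4 : M * (ξ - t) ≤ ε / 2 := by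
    calc M * (ξ - t) ≤ M * (ε / (2 * M)) := by gcongr; linarith [hξ.2]
      _ = ε / 2 := by field_simp
  have h5 := abs_sub_abs_le_abs_sub (g t) (g ξ)
  rw [abs_sub_comm] at h5
  linarith

/-- If `L` and its derivative both converge, then the derivative tends to `0`. -/
theorem eq_zero_of_tendsto_deriv {L g : ℝ → ℝ} {l d : ℝ}
    (hL : ∀ t, 0 ≤ t → HasDerivAt L (g t) t) (hl : Tendsto L atTop (𝓝 l))
    (hd : Tendsto g atTop (𝓝 d)) : d = 0 := by
  have h1 : Tendsto (fun t => L (t + 1) - L t) atTop (𝓝 0) := by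
    simpa using (hl.comp (tendsto_atTop_add_const_right _ 1 tendsto_id)).sub hl
  have hex : ∀ t : ℝ, ∃ ξ, t ≤ ξ ∧ (0 ≤ t → g ξ = L (t + 1) - L t) := by
    intro t
    by_cases ht : 0 ≤ t
    · obtain ⟨ξ, hξ, hξ'⟩ := exists_hasDerivAt_eq_slope L g (lt_add_one t)
        (fun s hs => (hL s (ht.trans hs.1)).continuousAt.continuousWithinAt)
        (fun s hs => hL s (ht.trans hs.1.le))
      exact ⟨ξ, hξ.1.le, fun _ => by simpa using hξ'⟩
    · exact ⟨t, le_rfl, fun h => absurd h ht⟩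
  choose ξ hξ hξ' using hex
  have h2 : Tendsto (fun t => g (ξ t)) atTop (𝓝 d) :=
    hd.comp (tendsto_atTop_mono hξ tendsto_id)
  refine tendsto_nhds_unique h2 (h1.congr' ?_)
  filter_upwards [eventually_ge_atTop 0] with t ht using (hξ' t ht).symm

/-! ### Trajectories with bounded `h = 1/x` and their limit values -/

/-- A forward trajectory of the system, with `h = 1 / x` in place of `x`. -/
structure IsTrajectory (V φ h w : ℝ → ℝ) : Prop where
  deriv_φ : ∀ t, 0 ≤ t → HasDerivAt φ (w t) t
  deriv_h : ∀ t, 0 ≤ t → HasDerivAt h (√(3 / 2) * h t * w t ^ 2) t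
  deriv_w : ∀ t, 0 ≤ t →
    HasDerivAt w (√(3 / 2) * w t * (1 - w t ^ 2) - deriv V (φ t) / (2 * h t ^ 2)) t
  pos : ∀ t, 0 ≤ t → 0 < h t
  constraint : ∀ t, 0 ≤ t → V (φ t) = h t ^ 2 * (1 - w t ^ 2)
  bounded : ∃ M, ∀ t, 0 ≤ t → |w t| ≤ M ∧ |deriv V (φ t)| ≤ M * h t ^ 2

/-- The symmetry `(φ, w, V) ↦ (-φ, -w, V(-·))` reduces negative velocities to positive ones. -/
theorem IsPotential.reflect {V : ℝ → ℝ} (hV : IsPotential V) : IsPotential fun s => V (-s) where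
  contDiff := hV.contDiff.comp contDiff_neg
  bot := by
    filter_upwards [tendsto_neg_atBot_atTop.eventually hV.top] with s hs
    simpa [deriv_comp_neg] using hs
  top := by
    filter_upwards [tendsto_neg_atTop_atBot.eventually hV.bot] with s hs
    simpa [deriv_comp_neg] using hs
  slope := by
    obtain ⟨K, hK⟩ := hV.slope
    rw [eventually_sup] at hK
    refine ⟨K, eventually_sup.2 ⟨?_, ?_⟩⟩
    · filter_upwards [tendsto_neg_atBot_atTop.eventually hK.2] with s hs
      simpa [deriv_comp_neg] using hs
    · filter_upwards [tendsto_neg_atTop_atBot.eventually hK.1] with s hs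
      simpa [deriv_comp_neg] using hs

/-- The critical values of `V` and its finite limits at `±∞`. -/
def limitValues (V : ℝ → ℝ) : Set ℝ :=
  V '' {φ | deriv V φ = 0} ∪ ({v | Tendsto V atTop (𝓝 v)} ∪ {v | Tendsto V atBot (𝓝 v)})

theorem limitValues_reflect (V : ℝ → ℝ) : limitValues (fun s => V (-s)) ⊆ limitValues V := by
  rintro v (⟨φ, hφ, rfl⟩ | h | h)
  · exact Or.inl ⟨-φ, by simpa [deriv_comp_neg] using hφ, rfl⟩
  · refine Or.inr (Or.inr ?_)
    have := Tendsto.comp h tendsto_neg_atBot_atTop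
    simpa [Function.comp_def] using this
  · refine Or.inr (Or.inl ?_)
    have := Tendsto.comp h tendsto_neg_atTop_atBot
    simpa [Function.comp_def] using this

namespace IsTrajectory

variable {V φ h w : ℝ → ℝ} {H : ℝ}

theorem reflect (tr : IsTrajectory V φ h w) :
    IsTrajectory (fun s => V (-s)) (fun t => -φ t) h fun t => -w t where
  deriv_φ t ht := (tr.deriv_φ t ht).neg
  deriv_h t ht := by simpa using tr.deriv_h t ht
  deriv_w t ht := by
    refine (tr.deriv_w t ht).neg.congr_deriv ?_
    rw [deriv_comp_neg, neg_neg]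
    ring
  pos := tr.pos
  constraint t ht := by simpa using tr.constraint t ht
  bounded := by simpa [deriv_comp_neg] using tr.bounded

theorem shift (tr : IsTrajectory V φ h w) {a : ℝ} (ha : 0 ≤ a) :
    IsTrajectory V (fun t => φ (t + a)) (fun t => h (t + a)) fun t => w (t + a) where
  deriv_φ t ht := (tr.deriv_φ (t + a) (by positivity)).comp_add_const t a
  deriv_h t ht := (tr.deriv_h (t + a) (by positivity)).comp_add_const t a
  deriv_w t ht := (tr.deriv_w (t + a) (by positivity)).comp_add_const t a
  pos t ht := tr.pos _ (by positivity)
  constraint t ht := tr.constraint _ (by positivity)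
  bounded := tr.bounded.imp fun M hM t ht => hM _ (by positivity)

theorem monotoneOn_h (tr : IsTrajectory V φ h w) : MonotoneOn h (Ici 0) := by
  refine monotoneOn_of_hasDerivWithinAt_nonneg (convex_Ici 0)
    (fun t ht => (tr.deriv_h t ht).continuousAt.continuousWithinAt)
    (fun t ht => (tr.deriv_h t (interior_subset ht)).hasDerivWithinAt) fun t ht => ?_
  have := tr.pos t (interior_subset ht)
  positivity

theorem h_le (tr : IsTrajectory V φ h w) (hH : Tendsto h atTop (𝓝 H)) {t : ℝ} (ht : 0 ≤ t) :
    h t ≤ H :=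
  ge_of_tendsto hH ((eventually_ge_atTop t).mono fun _ hs => tr.monotoneOn_h ht (ht.trans hs) hs)

theorem h_lt (tr : IsTrajectory V φ h w) {a t : ℝ} (ha : 0 ≤ a) (hat : a < t) (hw : w a ≠ 0) :
    h a < h t := by
  have hpos := tr.pos a ha
  have h1 := (tr.deriv_h a ha).eventually_nhdsGT_lt (by positivity)
  obtain ⟨s, hs, hs'⟩ := (h1.and (Ioo_mem_nhdsGT hat)).exists
  exact hs.trans_le (tr.monotoneOn_h (ha.trans hs'.1.le) (ha.trans hat.le) hs'.2.le)

theorem potential_le (tr : IsTrajectory V φ h w) {t : ℝ} (ht : 0 ≤ t) : V (φ t) ≤ h t ^ 2 := by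
  rw [tr.constraint t ht]
  nlinarith [mul_nonneg (sq_nonneg (h t)) (sq_nonneg (w t))]

/-- Along a trajectory with bounded `h`, the velocity tends to `0`. -/
theorem tendsto_w (tr : IsTrajectory V φ h w) (hH : Tendsto h atTop (𝓝 H)) :
    Tendsto w atTop (𝓝 0) := by
  obtain ⟨M, hM⟩ := tr.bounded
  have hM0 : 0 ≤ M := (abs_nonneg _).trans (hM 0 le_rfl).1
  have hHpos : 0 < H := (tr.pos 0 le_rfl).trans_le (tr.h_le hH le_rfl)
  set c := √(3 / 2) with hc
  have hc0 : 0 ≤ c := Real.sqrt_nonneg _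
  set A := c * M * (1 + M ^ 2) + M
  have hacc : ∀ t, 0 ≤ t → |c * w t * (1 - w t ^ 2) - deriv V (φ t) / (2 * h t ^ 2)| ≤ A := by
    intro t ht
    obtain ⟨h1, h2⟩ := hM t ht
    have hp := tr.pos t ht
    have h3 : |c * w t * (1 - w t ^ 2)| ≤ c * M * (1 + M ^ 2) := by
      rw [abs_mul, abs_mul, abs_of_nonneg hc0]
      gcongr
      refine (abs_sub _ _).trans ?_
      rw [abs_one, abs_pow]
      gcongr
    have h4 : |deriv V (φ t) / (2 * h t ^ 2)| ≤ M := by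
      rw [abs_div, abs_of_pos (by positivity : 0 < 2 * h t ^ 2), div_le_iff₀ (by positivity)]
      nlinarith [mul_nonneg hM0 (sq_nonneg (h t))]
    exact (abs_sub _ _).trans (add_le_add h3 h4)
  have hderiv : ∀ t, 0 ≤ t → HasDerivAt (fun t => c * w t ^ 2)
      (c * (2 * w t * (c * w t * (1 - w t ^ 2) - deriv V (φ t) / (2 * h t ^ 2)))) t := fun t ht =>
    (((tr.deriv_w t ht).pow 2).const_mul c).congr_deriv (by push_cast; ring)
  -- Barbalat applied to `log h`, whose derivative is `c w²`. That derivative is Lipschitz because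
  -- `w` and its acceleration are bounded.
  have hlog : Tendsto (fun t => c * w t ^ 2) atTop (𝓝 0) := by
    refine tendsto_zero_of_tendsto_of_lipschitz (L := fun t => Real.log (h t))
      (M := c * (2 * M * A) + 1) ?_ (by positivity) ?_ (hH.log hHpos.ne')
    · intro t ht
      have hp := tr.pos t ht
      exact ((tr.deriv_h t ht).log hp.ne').congr_deriv (by rw [hc]; field_simp)
    · intro s t hs hst
      have := (convex_Icc s t).norm_image_sub_le_of_norm_hasDerivWithin_le
        (f := fun t => c * w t ^ 2) (C := c * (2 * M * A))
        (fun r hr => (hderiv r (hs.trans hr.1)).hasDerivWithinAt) (fun r hr => by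
          have hr0 := hs.trans hr.1
          rw [Real.norm_eq_abs, abs_mul, abs_mul, abs_mul, abs_of_nonneg hc0, abs_two]
          gcongr
          exacts [(hM r hr0).1, hacc r hr0]) ⟨le_rfl, hst⟩ ⟨hst, le_rfl⟩
      rw [Real.norm_eq_abs, Real.norm_eq_abs, abs_of_nonneg (sub_nonneg.2 hst)] at this
      linarith
  have hcpos : 0 < c := by positivity
  have hsq : Tendsto (fun t => w t ^ 2) atTop (𝓝 0) := by
    have := hlog.const_mul c⁻¹
    simpa [hcpos.ne'] using this
  have := hsq.sqrt
  simp only [Real.sqrt_sq_eq_abs, Real.sqrt_zero] at this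
  exact (tendsto_zero_iff_abs_tendsto_zero w).2 this

theorem tendsto_potential (tr : IsTrajectory V φ h w) (hH : Tendsto h atTop (𝓝 H)) :
    Tendsto (fun t => V (φ t)) atTop (𝓝 (H ^ 2)) := by
  have h1 : Tendsto (fun t => h t ^ 2 * (1 - w t ^ 2)) atTop (𝓝 (H ^ 2 * (1 - 0 ^ 2))) :=
    (hH.pow 2).mul (((tr.tendsto_w hH).pow 2).const_sub 1)
  simp only [ne_eq, OfNat.ofNat_ne_zero, not_false_eq_true, zero_pow, sub_zero, mul_one] at h1
  refine h1.congr' ?_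
  filter_upwards [eventually_ge_atTop 0] with t ht using (tr.constraint t ht).symm

/-- At an interior minimum `m` of `φ` on `[a, b]` one has `w = 0`, so `V(φ m) = h(m)²`. As `φ 0 < φ
m < φ a`, the same value of `φ` was taken at some time `r ≤ a`, where `V ≤ h(r)² ≤ h(a)² < h(m)²`, a
contradiction. -/
theorem not_turn_up (tr : IsTrajectory V φ h w) {a b : ℝ} (ha : 0 ≤ a) (hab : a < b)
    (hgt : ∀ t, a ≤ t → φ 0 < φ t) (hwa : w a < 0) (hwb : 0 < w b) : False := by
  have hcont : ContinuousOn φ (Ici 0) := fun t ht =>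
    (tr.deriv_φ t ht).continuousAt.continuousWithinAt
  obtain ⟨m, hm, hmin⟩ := isCompact_Icc.exists_isMinOn (nonempty_Icc.2 hab.le)
    (hcont.mono fun t ht => ha.trans ht.1 : ContinuousOn φ (Icc a b))
  have hma : φ m < φ a := by
    have h1 := (tr.deriv_φ a ha).neg.eventually_nhdsGT_lt (by linarith)
    obtain ⟨s, hs, hs'⟩ := (h1.and (Ioo_mem_nhdsGT hab)).exists
    exact (hmin (Ioo_subset_Icc_self hs')).trans_lt (neg_lt_neg_iff.1 hs)
  have hmb : φ m < φ b := by
    have h1 := (tr.deriv_φ b (ha.trans hab.le)).eventually_nhdsLT_lt hwb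
    obtain ⟨s, hs, hs'⟩ := (h1.and (Ioo_mem_nhdsLT hab)).exists
    exact (hmin (Ioo_subset_Icc_self hs')).trans_lt hs
  have ham : a < m := hm.1.lt_of_ne (by rintro rfl; exact lt_irrefl _ hma)
  have hbm : m < b := hm.2.lt_of_ne (by rintro rfl; exact lt_irrefl _ hmb)
  have hm0 : 0 ≤ m := ha.trans ham.le
  have hwm : w m = 0 :=
    (hmin.isLocalMin (Icc_mem_nhds ham hbm)).hasDerivAt_eq_zero (tr.deriv_φ m hm0)
  obtain ⟨r, hr, hrm⟩ := intermediate_value_Icc ha (hcont.mono fun t ht => ht.1)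
    ⟨(hgt m ham.le).le, hma.le⟩
  have h1 := tr.constraint m hm0
  have h2 := tr.potential_le hr.1
  have h3 := tr.monotoneOn_h hr.1 ha hr.2
  have h4 := tr.h_lt ha ham hwa.ne
  rw [hrm, h1, hwm] at h2
  nlinarith [tr.pos r hr.1]

theorem eventually_sign_of_gt (tr : IsTrajectory V φ h w)
    (hgt : ∀ᶠ t in atTop, φ 0 < φ t) :
    (∀ᶠ t in atTop, 0 ≤ w t) ∨ ∀ᶠ t in atTop, w t ≤ 0 := by
  obtain ⟨T, hT⟩ := eventually_atTop.1 (hgt.and (eventually_ge_atTop 0))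
  by_cases hex : ∃ a ≥ T, w a < 0
  · obtain ⟨a, haT, hwa⟩ := hex
    refine Or.inr ((eventually_gt_atTop a).mono fun b hb => ?_)
    by_contra! hwb
    exact tr.not_turn_up (hT a haT).2 hb (fun t ht => (hT t (haT.trans ht)).1) hwa hwb
  · push Not at hex
    exact Or.inl ((eventually_ge_atTop T).mono hex)

/-- Along a trajectory with bounded `h`, the velocity eventually has a constant sign. -/
theorem eventually_sign (tr : IsTrajectory V φ h w)
    (hH : Tendsto h atTop (𝓝 H)) :
    (∀ᶠ t in atTop, 0 ≤ w t) ∨ ∀ᶠ t in atTop, w t ≤ 0 := by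
  -- If `V(φ 0) < H²`, then `V(φ) → H²` keeps `φ` away from `φ 0` eventually, hence on one side of
  -- it, and the turning argument applies there. Otherwise `H² ≤ V(φ 0) ≤ h(0)²` forces `h` to be
  -- constant and `w = 0`.
  rcases lt_or_ge (V (φ 0)) (H ^ 2) with hlt | hge
  · obtain ⟨T, hT⟩ := eventually_atTop.1
      (((tr.tendsto_potential hH).eventually (lt_mem_nhds hlt)).and (eventually_ge_atTop 0))
    have hne : ∀ t ∈ Ici T, φ t ≠ φ 0 := fun t ht he => by
      have := (hT t ht).1
      rw [he] at this
      exact lt_irrefl _ this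
    have hcont : ContinuousOn φ (Ici T) := fun t ht =>
      (tr.deriv_φ t (hT t ht).2).continuousAt.continuousWithinAt
    by_cases hex : φ 0 < φ T
    · refine tr.eventually_sign_of_gt ((eventually_ge_atTop T).mono fun t ht => ?_)
      by_contra! hle
      obtain ⟨s, hs, hs'⟩ := intermediate_value_Icc' ht
        (hcont.mono Icc_subset_Ici_self) ⟨hle, hex.le⟩
      exact hne s hs.1 hs'
    · have := tr.reflect.eventually_sign_of_gt ((eventually_ge_atTop T).mono fun t ht => ?_)
      · simpa [or_comm] using this
      by_contra! hle
      obtain ⟨s, hs, hs'⟩ := intermediate_value_Icc ht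
        (hcont.mono Icc_subset_Ici_self) ⟨not_lt.1 hex, neg_le_neg_iff.1 hle⟩
      exact hne s hs.1 hs'
  · have hw : ∀ t, 0 ≤ t → w t = 0 := by
      intro t ht
      by_contra hne
      have h1 := tr.h_lt ht (lt_add_one t) hne
      have h2 := tr.h_le hH (t := t + 1) (by positivity)
      have h3 := tr.monotoneOn_h self_mem_Ici ht ht
      have h4 := tr.potential_le le_rfl
      nlinarith [tr.pos 0 le_rfl]
    exact Or.inl ((eventually_ge_atTop 0).mono fun t ht => (hw t ht).ge)

/-- A trajectory with bounded `h` and nonnegative velocity converges in the extended reals. -/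
theorem tendsto_φ (tr : IsTrajectory V φ h w) (hw : ∀ᶠ t in atTop, 0 ≤ w t) :
    Tendsto φ atTop atTop ∨ ∃ l, Tendsto φ atTop (𝓝 l) := by
  obtain ⟨T, hT⟩ := eventually_atTop.1 (hw.and (eventually_ge_atTop 0))
  have hmono : MonotoneOn φ (Ici T) :=
    monotoneOn_of_hasDerivWithinAt_nonneg (convex_Ici T)
      (fun t ht => (tr.deriv_φ t (hT t ht).2).continuousAt.continuousWithinAt)
      (fun t ht => (tr.deriv_φ t (hT t (interior_subset ht)).2).hasDerivWithinAt)
      fun t ht => (hT t (interior_subset ht)).1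
  have hmono' : Monotone fun t => φ (max T t) := fun s t hst =>
    hmono (mem_Ici.2 (le_max_left _ _)) (mem_Ici.2 (le_max_left _ _)) (max_le_max_left T hst)
  have heq : (fun t => φ (max T t)) =ᶠ[atTop] φ := by
    filter_upwards [eventually_ge_atTop T] with t ht
    rw [max_eq_right ht]
  exact (tendsto_atTop_of_monotone hmono').imp (fun h => h.congr' heq)
    fun ⟨l, h⟩ => ⟨l, h.congr' heq⟩

/-- If `φ → ∞`, then `V`, being monotone near `+∞`, has a limit there, which must be `H²`. If `φ →
l`, the acceleration tends to `-V'(l) / (2H²)`, and this vanishes because `w` converges. -/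
theorem sq_mem_limitValues_of_nonneg (tr : IsTrajectory V φ h w) (hV : IsPotential V)
    (hH : Tendsto h atTop (𝓝 H)) (hw : ∀ᶠ t in atTop, 0 ≤ w t) : H ^ 2 ∈ limitValues V := by
  have hHpos : 0 < H := (tr.pos 0 le_rfl).trans_le (tr.h_le hH le_rfl)
  have hpot := tr.tendsto_potential hH
  have hw0 := tr.tendsto_w hH
  rcases tr.tendsto_φ hw with htop | ⟨l, hl⟩
  · obtain ⟨R, hR⟩ := eventually_atTop.1 hV.top
    have hmono : MonotoneOn V (Ici R) :=
      monotoneOn_of_deriv_nonneg (convex_Ici R) hV.continuous.continuousOn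
        (hV.contDiff.differentiable two_ne_zero).differentiableOn
        fun s hs => (hR s (interior_subset hs)).2.le
    have hmono' : Monotone fun s => V (max R s) := fun s t hst =>
      hmono (mem_Ici.2 (le_max_left _ _)) (mem_Ici.2 (le_max_left _ _)) (max_le_max_left R hst)
    have heq : (fun s => V (max R s)) =ᶠ[atTop] V := by
      filter_upwards [eventually_ge_atTop R] with t ht
      rw [max_eq_right ht]
    refine Or.inr (Or.inl ?_)
    rcases tendsto_atTop_of_monotone hmono' with h1 | ⟨v, h1⟩
    · exact absurd hpot (not_tendsto_nhds_of_tendsto_atTop ((h1.congr' heq).comp htop) _)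
    · have h2 := h1.congr' heq
      rwa [tendsto_nhds_unique hpot (h2.comp htop)]
  · refine Or.inl ⟨l, ?_, tendsto_nhds_unique ((hV.continuous.tendsto l).comp hl) hpot⟩
    have hacc : Tendsto (fun t => √(3 / 2) * w t * (1 - w t ^ 2) -
        deriv V (φ t) / (2 * h t ^ 2)) atTop
        (𝓝 (√(3 / 2) * 0 * (1 - 0 ^ 2) - deriv V l / (2 * H ^ 2))) :=
      ((hw0.const_mul _).mul ((hw0.pow 2).const_sub 1)).sub
        (((hV.contDiff_deriv.continuous.tendsto l).comp hl).div ((hH.pow 2).const_mul 2)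
          (by positivity))
    have := eq_zero_of_tendsto_deriv tr.deriv_w hw0 hacc
    have h2 : deriv V l / (2 * H ^ 2) = 0 := by linarith
    exact (div_eq_zero_iff.1 h2).resolve_right (by positivity)

/-- If `h` converges to `H` along a trajectory, then `H²` is a critical value of `V` or a limit of
`V` at infinity. -/
theorem sq_mem_limitValues (tr : IsTrajectory V φ h w) (hV : IsPotential V)
    (hH : Tendsto h atTop (𝓝 H)) : H ^ 2 ∈ limitValues V := by
  rcases tr.eventually_sign hH with hw | hw
  · exact tr.sq_mem_limitValues_of_nonneg hV hH hw
  · exact limitValues_reflect V (tr.reflect.sq_mem_limitValues_of_nonneg hV.reflect hH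
      (hw.mono fun t ht => neg_nonneg.2 ht))

end IsTrajectory

/-- The sign of `V'` outside a compact interval confines the critical points to it, and each end
contributes at most one limit. -/
theorem IsPotential.bddAbove_limitValues {V : ℝ → ℝ} (hV : IsPotential V) :
    BddAbove (limitValues V) := by
  have hsub : ∀ l : Filter ℝ, l.NeBot → {v | Tendsto V l (𝓝 v)}.Subsingleton :=
    fun l hl v hv v' hv' => tendsto_nhds_unique hv hv'
  refine BddAbove.union ?_ ((hsub _ inferInstance).finite.bddAbove.union
    (hsub _ inferInstance).finite.bddAbove)
  obtain ⟨R, hR, hbot, htop⟩ := hV.exists_pos_outside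
  have hcrit : {φ | deriv V φ = 0} ⊆ Icc (-R) R := by
    intro s hs
    constructor
    · by_contra! hlt
      exact (hbot s hlt.le).2.ne hs
    · by_contra! hlt
      exact (htop s hlt.le).2.ne' hs
  exact (isCompact_Icc.image hV.continuous).bddAbove.mono (image_mono hcrit)

/-- Sard's theorem in dimension one, plus at most two further points. -/
theorem IsPotential.volume_limitValues {V : ℝ → ℝ} (hV : IsPotential V) :
    MeasureTheory.volume (limitValues V) = 0 := by
  have hsub : ∀ l : Filter ℝ, l.NeBot → {v | Tendsto V l (𝓝 v)}.Subsingleton :=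
    fun l hl v hv v' hv' => tendsto_nhds_unique hv hv'
  refine MeasureTheory.measure_union_null ?_ (MeasureTheory.measure_union_null
    ((hsub _ inferInstance).finite.measure_zero MeasureTheory.volume)
    ((hsub _ inferInstance).finite.measure_zero MeasureTheory.volume))
  refine MeasureTheory.addHaar_image_eq_zero_of_det_fderivWithin_eq_zero _
    (f' := fun _ => 0) (fun x hx => ?_) fun x _ => by simp [ContinuousLinearMap.det]
  have h := hV.hasDerivAt x
  rw [show deriv V x = 0 from hx] at h
  have h0 : ContinuousLinearMap.toSpanSingleton ℝ (0 : ℝ) = 0 := by ext; simp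
  exact (h0 ▸ h.hasFDerivAt).hasFDerivWithinAt

/-! ### Comparison of two trajectories as graphs over the scalar field -/

/-- The inverse of a strictly increasing continuous function is continuous. -/
theorem StrictMono.continuousAt_invFun {f : ℝ → ℝ} (hf : StrictMono f) (hc : Continuous f) (a : ℝ) :
    ContinuousAt (Function.invFun f) (f a) := by
  have hinv : ∀ b, Function.invFun f (f b) = b := Function.leftInverse_invFun hf.injective
  rw [Metric.continuousAt_iff']
  intro ε hε
  filter_upwards [Ioo_mem_nhds (hf (sub_lt_self a hε)) (hf (lt_add_of_pos_right a hε))] with y hy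
  obtain ⟨b, hb, rfl⟩ := intermediate_value_Ioo (by linarith) hc.continuousOn hy
  rw [hinv, hinv, Real.dist_eq, abs_lt]
  exact ⟨by linarith [hb.1], by linarith [hb.2]⟩

theorem StrictMono.hasDerivAt_invFun {f : ℝ → ℝ} (hf : StrictMono f) (hc : Continuous f) {a f' : ℝ}
    (hd : HasDerivAt f f' a) (hf' : f' ≠ 0) : HasDerivAt (Function.invFun f) f'⁻¹ (f a) := by
  have hinv : ∀ b, Function.invFun f (f b) = b := Function.leftInverse_invFun hf.injective
  refine HasDerivAt.of_local_left_inverse (f := f) (hf.continuousAt_invFun hc a)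
    (by rwa [hinv]) hf' ?_
  filter_upwards [Ioo_mem_nhds (hf (sub_one_lt a)) (hf (lt_add_one a))] with y hy
  obtain ⟨b, -, rfl⟩ := intermediate_value_Ioo (by linarith) hc.continuousOn hy
  rw [hinv]

/-- A function whose derivative is nonnegative where it is positive stays above its positive
initial value. -/
theorem initial_le_of_deriv_nonneg_of_pos {D D' : ℝ → ℝ} {T : ℝ} (hc : ContinuousOn D (Icc 0 T))
    (hd : ∀ s ∈ Ioo 0 T, HasDerivAt D (D' s) s) (hD' : ∀ s ∈ Ioo 0 T, 0 < D s → 0 ≤ D' s)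
    (h0 : 0 < D 0) : ∀ s ∈ Icc 0 T, D 0 ≤ D s := by
  intro s hs
  by_contra! hlt
  have hsub : Icc 0 s ⊆ Icc 0 T := Icc_subset_Icc_right hs.2
  have hclosed : IsClosed {r ∈ Icc 0 s | D 0 ≤ D r} :=
    (hc.mono hsub).preimage_isClosed_of_isClosed isClosed_Icc isClosed_Ici
  -- `m` is the last time up to `s` with `D ≥ D 0`. Just after `m` the function is still positive,
  -- hence nondecreasing, which contradicts maximality.
  obtain ⟨m, ⟨hm, hDm⟩, hmax⟩ := (isCompact_Icc.of_isClosed_subset hclosed fun r hr =>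
    hr.1).exists_isGreatest ⟨0, ⟨le_rfl, hs.1⟩, le_rfl⟩
  have hms : m < s := hm.2.lt_of_ne (by rintro rfl; linarith)
  have hev : ∀ᶠ r in 𝓝[≥] m, 0 < D r ∧ r < s := by
    refine Filter.Eventually.and ?_ (nhdsWithin_le_nhds (Iio_mem_nhds hms))
    have h1 : ContinuousWithinAt D (Icc m s) m :=
      (hc m (hsub hm)).mono (Icc_subset_Icc hm.1 hs.2)
    have h2 := (continuousWithinAt_Icc_iff_Ici hms).1 h1
    exact h2.eventually (lt_mem_nhds (h0.trans_le hDm))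
  obtain ⟨r, hmr, hr⟩ := (mem_nhdsGE_iff_exists_Icc_subset).1 hev
  have hrs : r < s := (hr ⟨le_of_lt hmr, le_rfl⟩).2
  have hsub' : Icc m r ⊆ Icc 0 T := Icc_subset_Icc hm.1 (hrs.le.trans hs.2)
  have hint : ∀ t ∈ interior (Icc m r), t ∈ Ioo 0 T := fun t ht => by
    rw [interior_Icc] at ht
    exact ⟨hm.1.trans_lt ht.1, (ht.2.trans hrs).trans_le hs.2⟩
  have hmono := monotoneOn_of_hasDerivWithinAt_nonneg (convex_Icc m r) (hc.mono hsub')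
    (fun t ht => (hd t (hint t ht)).hasDerivWithinAt)
    (fun t ht => hD' t (hint t ht) (hr (interior_subset ht)).1)
  have h3 := hmono ⟨le_rfl, le_of_lt hmr⟩ ⟨le_of_lt hmr, le_rfl⟩ (le_of_lt hmr)
  exact absurd (hmax ⟨⟨hm.1.trans (le_of_lt hmr), hrs.le⟩, hDm.trans h3⟩) (not_le.2 hmr)

namespace IsTrajectory

variable {V φ h w φ' h' w' : ℝ → ℝ} {H H' : ℝ}

theorem continuousOn_φ (tr : IsTrajectory V φ h w) : ContinuousOn φ (Ici 0) := fun t ht =>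
  (tr.deriv_φ t ht).continuousAt.continuousWithinAt

theorem continuousOn_h (tr : IsTrajectory V φ h w) : ContinuousOn h (Ici 0) := fun t ht =>
  (tr.deriv_h t ht).continuousAt.continuousWithinAt

theorem strictMonoOn_φ (tr : IsTrajectory V φ h w) (hw : ∀ t, 0 ≤ t → 0 < w t) :
    StrictMonoOn φ (Ici 0) :=
  strictMonoOn_of_hasDerivWithinAt_pos (convex_Ici 0) tr.continuousOn_φ
    (fun t ht => (tr.deriv_φ t (interior_subset ht)).hasDerivWithinAt)
    fun t ht => hw t (interior_subset ht)

/-- Comparison of two trajectories with positive velocity as graphs of `h` over `φ`: the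
difference of the values of `h` does not decrease. -/
theorem exists_time_of_mem_image (tr : IsTrajectory V φ h w) (tr' : IsTrajectory V φ' h' w')
    (hw : ∀ t, 0 ≤ t → 0 < w t) (hw' : ∀ t, 0 ≤ t → 0 < w' t) (hφ : φ 0 = φ' 0) (hh : h 0 < h' 0)
    {t : ℝ} (ht : 0 ≤ t) (hmem : φ t ∈ φ' '' Ici 0) :
    ∃ s, 0 ≤ s ∧ φ' s = φ t ∧ h t + (h' 0 - h 0) ≤ h' s := by
  obtain ⟨τ, hτ, hφτ⟩ := hmem
  have hmono := tr.strictMonoOn_φ hw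
  have hmono' := tr'.strictMonoOn_φ hw'
  -- Continuing `φ'` with slope `1` to negative times gives a strictly increasing function on the
  -- whole line. Its inverse then defines `g s`, the time at which the second trajectory has field
  -- value `φ s`.
  let Φ : ℝ → ℝ := fun s => φ' (max s 0) + min s 0
  have hΦpos : ∀ s, 0 ≤ s → Φ s = φ' s := fun s hs => by simp [Φ, hs]
  have hΦmono : StrictMono Φ := by
    intro a b hab
    rcases le_or_gt 0 a with ha | ha
    · rw [hΦpos a ha, hΦpos b (ha.trans hab.le)]
      exact hmono' ha (ha.trans hab.le) hab
    · have h1 : φ' (max a 0) ≤ φ' (max b 0) :=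
        hmono'.monotoneOn (mem_Ici.2 (le_max_right _ _)) (mem_Ici.2 (le_max_right _ _))
          (max_le_max_right 0 hab.le)
      have h2 : min a 0 < min b 0 := by
        rw [min_eq_left ha.le]
        exact lt_min hab ha
      exact add_lt_add_of_le_of_lt h1 h2
  have hΦcont : Continuous Φ :=
    (tr'.continuousOn_φ.comp_continuous (by fun_prop) fun s => mem_Ici.2 (le_max_right _ _)).add
      (by fun_prop)
  have hinv : ∀ b, Function.invFun Φ (Φ b) = b := Function.leftInverse_invFun hΦmono.injective
  let g : ℝ → ℝ := fun s => Function.invFun Φ (φ s)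
  have hpre : ∀ s ∈ Icc 0 t, ∃ r, 0 ≤ r ∧ φ' r = φ s := by
    intro s hs
    obtain ⟨r, hr, hr'⟩ := intermediate_value_Icc hτ
      (tr'.continuousOn_φ.mono fun t ht => ht.1)
      (⟨hφ ▸ hmono.monotoneOn self_mem_Ici hs.1 hs.1,
        hφτ ▸ hmono.monotoneOn hs.1 ht hs.2⟩ : φ s ∈ Icc (φ' 0) (φ' τ))
    exact ⟨r, hr.1, hr'⟩
  have hg : ∀ s ∈ Icc 0 t, 0 ≤ g s ∧ φ' (g s) = φ s := by
    intro s hs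
    obtain ⟨r, hr, hr'⟩ := hpre s hs
    have : g s = r := by
      simp only [g]
      rw [← hr', ← hΦpos r hr, hinv]
    rw [this]
    exact ⟨hr, hr'⟩
  have hΦg : ∀ s ∈ Icc 0 t, Φ (g s) = φ s := fun s hs => by
    rw [hΦpos _ (hg s hs).1, (hg s hs).2]
  have hg0 : g 0 = 0 := by
    simp only [g]
    rw [hφ, ← hΦpos 0 le_rfl, hinv]
  have hgpos : ∀ s ∈ Ioo 0 t, 0 < g s := by
    intro s hs
    have hs' := Ioo_subset_Icc_self hs
    refine (hg s hs').1.lt_of_ne fun h0 => ?_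
    have h1 := (hg s hs').2
    rw [← h0, ← hφ] at h1
    exact (hmono self_mem_Ici hs'.1 hs.1).ne h1
  have hgcont : ContinuousOn g (Icc 0 t) := by
    intro s hs
    have h1 : ContinuousAt (Function.invFun Φ) (φ s) := by
      rw [← hΦg s hs]
      exact hΦmono.continuousAt_invFun hΦcont _
    exact (h1.comp (tr.deriv_φ s hs.1).continuousAt).continuousWithinAt
  have hgderiv : ∀ s ∈ Ioo 0 t, HasDerivAt g ((w' (g s))⁻¹ * w s) s := by
    intro s hs
    have hs' := Ioo_subset_Icc_self hs
    have hΦd : HasDerivAt Φ (w' (g s)) (g s) := by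
      refine (tr'.deriv_φ _ (hgpos s hs).le).congr_of_eventuallyEq ?_
      filter_upwards [lt_mem_nhds (hgpos s hs)] with r hr using hΦpos r hr.le
    have h1 := hΦmono.hasDerivAt_invFun hΦcont hΦd (hw' _ (hgpos s hs).le).ne'
    rw [hΦg s hs'] at h1
    exact h1.comp s (tr.deriv_φ s hs'.1)
  have key := initial_le_of_deriv_nonneg_of_pos (D := fun s => h' (g s) - h s)
    (D' := fun s => √(3 / 2) * h' (g s) * w' (g s) ^ 2 * ((w' (g s))⁻¹ * w s)
      - √(3 / 2) * h s * w s ^ 2)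
    ((tr'.continuousOn_h.comp hgcont fun s hs => (hg s hs).1).sub
      (tr.continuousOn_h.mono fun s hs => hs.1))
    (fun s hs => ((tr'.deriv_h _ (hgpos s hs).le).comp s (hgderiv s hs)).sub
      (tr.deriv_h s hs.1.le)) ?_ (by simpa [hg0] using hh) t ⟨ht, le_rfl⟩
  · rw [hg0] at key
    refine ⟨g t, (hg t ⟨ht, le_rfl⟩).1, (hg t ⟨ht, le_rfl⟩).2, by linarith⟩
  intro s hs hD
  obtain ⟨hgs, hφg⟩ := hg s (Ioo_subset_Icc_self hs)
  have hw1 := hw s hs.1.le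
  have hw2 := hw' _ hgs
  have hp1 := tr.pos s hs.1.le
  have hp2 := tr'.pos _ hgs
  have hc1 := tr.constraint s hs.1.le
  have hc2 := tr'.constraint _ hgs
  rw [hφg, hc1] at hc2
  -- Both trajectories see the same value of `V` here, and `(h w)² = h² - V` increases with `h`.
  have hle : h s * w s ≤ h' (g s) * w' (g s) := by
    refine (pow_le_pow_iff_left₀ (by positivity) (by positivity) two_ne_zero).1 ?_
    nlinarith
  have : √(3 / 2) * h' (g s) * w' (g s) ^ 2 * ((w' (g s))⁻¹ * w s) - √(3 / 2) * h s * w s ^ 2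
      = √(3 / 2) * w s * (h' (g s) * w' (g s) - h s * w s) := by
    field_simp
  rw [this]
  exact mul_nonneg (by positivity) (sub_nonneg.2 hle)

/-- The limit of `h` is an expanding function of its initial value among the trajectories with
positive velocity that start from a given value of the scalar field. -/
theorem limit_expanding (tr : IsTrajectory V φ h w) (tr' : IsTrajectory V φ' h' w')
    (hV : Continuous V) (hw : ∀ t, 0 ≤ t → 0 < w t) (hw' : ∀ t, 0 ≤ t → 0 < w' t)
    (hφ : φ 0 = φ' 0) (hh : h 0 < h' 0)
    (hH : Tendsto h atTop (𝓝 H)) (hH' : Tendsto h' atTop (𝓝 H')) :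
    H + (h' 0 - h 0) ≤ H' := by
  have hmono := tr.strictMonoOn_φ hw
  have hmono' := tr'.strictMonoOn_φ hw'
  have hle : ∀ t, 0 ≤ t → φ t ∈ φ' '' Ici 0 → h t + (h' 0 - h 0) ≤ H' := by
    intro t ht hmem
    obtain ⟨s, hs, -, hs'⟩ := tr.exists_time_of_mem_image tr' hw hw' hφ hh ht hmem
    exact hs'.trans (tr'.h_le hH' hs)
  suffices hall : ∀ t, 0 ≤ t → φ t ∈ φ' '' Ici 0 from
    le_of_tendsto (hH.add_const _) ((eventually_ge_atTop 0).mono fun t ht => hle t ht (hall t ht))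
  -- Suppose the second trajectory never attains a value `φ t` of the first. Then `φ'` converges to
  -- some `l ≤ φ t` with `V l = H'²`. The first trajectory reaches `l` at `t₀`, where `h(t₀)² ≥
  -- H'²`, whereas the comparison before `t₀` gives `h(t₀) < H'`.
  by_contra! hcon
  obtain ⟨t, ht, hnot⟩ := hcon
  have hbelow : ∀ s, 0 ≤ s → φ' s < φ t := by
    intro s hs
    by_contra! hge
    obtain ⟨r, hr, hr'⟩ := intermediate_value_Icc hs (tr'.continuousOn_φ.mono fun t ht => ht.1)
      (⟨hφ ▸ hmono.monotoneOn self_mem_Ici ht ht, hge⟩ : φ t ∈ Icc (φ' 0) (φ' s))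
    exact hnot ⟨r, hr.1, hr'⟩
  obtain ⟨l, hl⟩ : ∃ l, Tendsto φ' atTop (𝓝 l) := by
    refine (tr'.tendsto_φ ((eventually_ge_atTop 0).mono fun s hs => (hw' s hs).le)).resolve_left
      fun htop => ?_
    obtain ⟨s, hs, hs'⟩ := ((htop.eventually_ge_atTop (φ t)).and (eventually_ge_atTop 0)).exists
    exact (hbelow s hs').not_ge hs
  have hlt : ∀ s, 0 ≤ s → φ' s < l := fun s hs =>
    (hmono' hs (by positivity : (0 : ℝ) ≤ s + 1) (lt_add_one s)).trans_le
      (ge_of_tendsto hl ((eventually_ge_atTop (s + 1)).mono fun r hr =>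
        hmono'.monotoneOn (by positivity : (0 : ℝ) ≤ s + 1) (by simp; linarith) hr))
  have hl_le : l ≤ φ t :=
    le_of_tendsto hl ((eventually_ge_atTop 0).mono fun s hs => (hbelow s hs).le)
  have hVl : V l = H' ^ 2 :=
    tendsto_nhds_unique ((hV.tendsto l).comp hl) (tr'.tendsto_potential hH')
  obtain ⟨t₀, ht₀, hφt₀⟩ := intermediate_value_Icc ht (tr.continuousOn_φ.mono fun t ht => ht.1)
    (⟨hφ ▸ (hlt 0 le_rfl).le, hl_le⟩ : l ∈ Icc (φ 0) (φ t))
  have ht₀pos : 0 < t₀ := ht₀.1.lt_of_ne (by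
    rintro rfl
    exact (hlt 0 le_rfl).ne (hφ ▸ hφt₀))
  have hbefore : ∀ s ∈ Ioo 0 t₀, h s + (h' 0 - h 0) ≤ H' := by
    intro s hs
    refine hle s hs.1.le ?_
    have hsl : φ s < l := hφt₀ ▸ hmono hs.1.le ht₀.1 hs.2
    obtain ⟨r, hr, hr0⟩ := ((hl.eventually (lt_mem_nhds hsl)).and (eventually_ge_atTop 0)).exists
    obtain ⟨q, hq, hq'⟩ := intermediate_value_Icc hr0 (tr'.continuousOn_φ.mono fun t ht => ht.1)
      (⟨hφ ▸ hmono.monotoneOn self_mem_Ici hs.1.le hs.1.le, hr.le⟩ : φ s ∈ Icc (φ' 0) (φ' r))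
    exact ⟨q, hq.1, hq'⟩
  have hlim : h t₀ + (h' 0 - h 0) ≤ H' := by
    have h1 : Tendsto (fun s => h s + (h' 0 - h 0)) (𝓝[<] t₀) (𝓝 (h t₀ + (h' 0 - h 0))) :=
      ((tr.deriv_h t₀ ht₀.1).continuousAt.continuousWithinAt.tendsto).add_const _
    refine le_of_tendsto h1 ?_
    filter_upwards [Ioo_mem_nhdsLT ht₀pos] with s hs using hbefore s hs
  have h2 := tr.potential_le ht₀.1
  rw [hφt₀, hVl] at h2
  nlinarith [tr.pos t₀ ht₀.1, tr'.pos 0 le_rfl, tr'.h_le hH' le_rfl]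

end IsTrajectory

/-! ### The measure-theoretic contradiction -/

/-- It is impossible that all the trajectories starting at a given value of the scalar field, with
initial values of `h` filling an interval, have positive velocity forever and bounded `h`. -/
theorem IsPotential.not_forall_bounded {V : ℝ → ℝ} (hV : IsPotential V) {φ₀ a b : ℝ} (ha : 0 < a)
    (hab : a < b) (hyp : ∀ k ∈ Ioo a b, ∃ (φ h w : ℝ → ℝ) (H : ℝ), IsTrajectory V φ h w ∧
      φ 0 = φ₀ ∧ h 0 = k ∧ (∀ t, 0 ≤ t → 0 < w t) ∧ Tendsto h atTop (𝓝 H)) : False := by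
  choose! φ h w H tr hφ hh hw hH using hyp
  set Q : ℝ → ℝ := fun k => H k ^ 2 with hQ
  -- The factor `2a` comes from `H' + H ≥ 2a`, since each limit is at least its initial value `k >
  -- a`.
  have hexp : ∀ k ∈ Ioo a b, ∀ k' ∈ Ioo a b, k < k' → 2 * a * (k' - k) ≤ Q k' - Q k := by
    intro k hk k' hk' hlt
    have h1 := (tr k hk).limit_expanding (tr k' hk') hV.continuous (hw k hk) (hw k' hk')
      (by rw [hφ k hk, hφ k' hk']) (by rwa [hh k hk, hh k' hk']) (hH k hk) (hH k' hk')
    have h2 := (tr k hk).h_le (hH k hk) le_rfl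
    rw [hh k hk] at h1 h2
    rw [hh k' hk'] at h1
    simp only [hQ]
    nlinarith [hk.1]
  have hexp' : ∀ k ∈ Ioo a b, ∀ k' ∈ Ioo a b, 2 * a * |k - k'| ≤ |Q k - Q k'| := by
    intro k hk k' hk'
    rcases lt_trichotomy k k' with hlt | rfl | hlt
    · have := hexp k hk k' hk' hlt
      rw [abs_sub_comm k, abs_sub_comm (Q k), abs_of_pos (sub_pos.2 hlt)]
      exact this.trans (le_abs_self _)
    · simp
    · have := hexp k' hk' k hk hlt
      rw [abs_of_pos (sub_pos.2 hlt)]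
      exact this.trans (le_abs_self _)
  have hinj : InjOn Q (Ioo a b) := by
    intro k hk k' hk' heq
    have := hexp' k hk k' hk'
    rw [heq, sub_self, abs_zero] at this
    have h0 : |k - k'| ≤ 0 := nonpos_of_mul_nonpos_right this (by positivity)
    exact sub_eq_zero.1 (abs_nonpos_iff.1 h0)
  have hleft : LeftInvOn (Function.invFunOn Q (Ioo a b)) Q (Ioo a b) := hinj.leftInvOn_invFunOn
  have hlip : LipschitzOnWith (Real.toNNReal (2 * a)⁻¹) (Function.invFunOn Q (Ioo a b))
      (Q '' Ioo a b) := by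
    refine LipschitzOnWith.of_dist_le_mul ?_
    rintro _ ⟨k, hk, rfl⟩ _ ⟨k', hk', rfl⟩
    rw [hleft hk, hleft hk', Real.dist_eq, Real.dist_eq, Real.coe_toNNReal _ (by positivity),
      inv_mul_eq_div, le_div_iff₀ (by positivity), mul_comm]
    exact hexp' k hk k' hk'
  have hnull : MeasureTheory.volume (Q '' Ioo a b) = 0 := by
    refine MeasureTheory.measure_mono_null ?_ hV.volume_limitValues
    rintro _ ⟨k, hk, rfl⟩
    exact (tr k hk).sq_mem_limitValues hV (hH k hk)
  -- `(a, b)` is the image of the null set `Q '' Ioo a b` under the Lipschitz inverse of `Q`. On the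
  -- line, one-dimensional Hausdorff measure is Lebesgue measure.
  have h1 := hlip.hausdorffMeasure_image_le (d := 1) zero_le_one
  rw [MeasureTheory.hausdorffMeasure_real, hnull, mul_zero, hleft.image_image, Real.volume_Ioo]
    at h1
  simp only [nonpos_iff_eq_zero, ENNReal.ofReal_eq_zero] at h1
  linarith

/-- The force term is bounded on the constraint set. -/
theorem IsPotential.exists_force_bound {V : ℝ → ℝ} (hV : IsPotential V) (xbar : ℝ) :
    ∃ M, ∀ p ∈ phaseSet V xbar, |deriv V p.1| * p.2.1 ^ 2 ≤ M := by
  obtain ⟨K, hK⟩ := hV.slope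
  rw [eventually_sup, eventually_atBot, eventually_atTop] at hK
  obtain ⟨⟨a, ha⟩, b, hb⟩ := hK
  obtain ⟨R, hR, hbot, htop⟩ := hV.exists_pos_outside
  obtain ⟨C, hC⟩ := (isCompact_Icc (a := min a (-R)) (b := max b R)).exists_bound_of_continuousOn
    hV.contDiff_deriv.continuous.continuousOn
  -- Near infinity `|V'| x² ≤ K V x²`, and `V x² ≤ 1` by the constraint.
  have hout : ∀ p ∈ phaseSet V xbar, 0 < V p.1 → |deriv V p.1| ≤ K * V p.1 →
      |deriv V p.1| * p.2.1 ^ 2 ≤ |K| := by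
    intro p hp hpos hle
    have h1 : V p.1 * p.2.1 ^ 2 ≤ 1 := by nlinarith [hp.2]
    have h2 : 0 ≤ V p.1 * p.2.1 ^ 2 := by positivity
    calc |deriv V p.1| * p.2.1 ^ 2 ≤ K * V p.1 * p.2.1 ^ 2 := by gcongr
      _ = K * (V p.1 * p.2.1 ^ 2) := by ring
      _ ≤ |K| * (V p.1 * p.2.1 ^ 2) := by gcongr; exact le_abs_self K
      _ ≤ |K| := mul_le_of_le_one_right (abs_nonneg K) h1
  refine ⟨max |K| (C * xbar ^ 2), fun p hp => ?_⟩
  rcases le_total p.1 (min a (-R)) with h | h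
  · exact (hout p hp (hbot _ (h.trans (min_le_right _ _))).1
      (ha _ (h.trans (min_le_left _ _)))).trans (le_max_left _ _)
  rcases le_total (max b R) p.1 with h' | h'
  · exact (hout p hp (htop _ ((le_max_right _ _).trans h')).1
      (hb _ ((le_max_left _ _).trans h'))).trans (le_max_left _ _)
  · refine le_trans ?_ (le_max_right _ _)
    have h1 := hC p.1 ⟨h, h'⟩
    rw [Real.norm_eq_abs] at h1
    have h2 := hp.1.1
    have h3 := hp.1.2
    have h4 : 0 ≤ C := (abs_nonneg _).trans h1
    gcongr

namespace SolvesForward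

variable {V : ℝ → ℝ} {xbar : ℝ} {z y : ℝ → ℝ × ℝ × ℝ}

theorem components (hz : SolvesForward (phaseField V) z) {t : ℝ} (ht : 0 ≤ t) :
    HasDerivAt (fun t => (z t).1) (z t).2.2 t ∧
      HasDerivAt (fun t => (z t).2.1) (-√(3 / 2) * (z t).2.1 * (z t).2.2 ^ 2) t ∧
      HasDerivAt (fun t => (z t).2.2) (√(3 / 2) * (z t).2.2 * (1 - (z t).2.2 ^ 2)
        - 1 / 2 * deriv V (z t).1 * (z t).2.1 ^ 2) t := by
  have h := hasDerivWithinAt_triple_iff.1 ((hz t ht).hasDerivWithinAt (s := univ))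
  simpa only [hasDerivWithinAt_univ] using h

theorem mem_phaseSet (hV : IsPotential V) (hz : SolvesForward (phaseField V) z)
    (h0 : z 0 ∈ phaseSet V xbar) {t : ℝ} (ht : 0 ≤ t) : z t ∈ phaseSet V xbar :=
  (hz.solvesOn t).mem_phaseSet hV h0 t ⟨ht, le_rfl⟩

theorem eqOn (hV : IsPotential V) (hz : SolvesForward (phaseField V) z)
    (hy : SolvesForward (phaseField V) y) (h0 : z 0 = y 0) : EqOn z y (Ici 0) := fun t ht =>
  (hz.solvesOn t).eqOn hV.contDiff_phaseField (hy.solvesOn t) h0 ⟨ht, le_rfl⟩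

theorem isTrajectory (hV : IsPotential V) (hz : SolvesForward (phaseField V) z)
    (h0 : z 0 ∈ phaseSet V xbar) : IsTrajectory V (fun t => (z t).1) (fun t => ((z t).2.1)⁻¹)
      fun t => (z t).2.2 := by
  have hmem : ∀ t, 0 ≤ t → z t ∈ phaseSet V xbar := fun t ht => hz.mem_phaseSet hV h0 ht
  obtain ⟨W, hW, hWb⟩ := hV.exists_velocity_bound xbar
  obtain ⟨M, hM⟩ := hV.exists_force_bound xbar
  refine ⟨fun t ht => (hz.components ht).1, fun t ht => ?_, fun t ht => ?_,
    fun t ht => inv_pos.2 (hmem t ht).1.1, fun t ht => ?_, max W M, fun t ht => ?_⟩ <;>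
  have hx := (hmem t ht).1.1
  · exact ((hz.components ht).2.1.inv hx.ne').congr_deriv (by field_simp)
  · exact (hz.components ht).2.2.congr_deriv (by field_simp)
  · have := (hmem t ht).2
    field_simp
    linarith
  · refine ⟨(hWb _ (hmem t ht)).trans (le_max_left _ _), ?_⟩
    have := (hM _ (hmem t ht)).trans (le_max_right W M)
    rw [inv_pow, ← div_eq_mul_inv, le_div_iff₀ (by positivity)]
    exact this

/-- Either `x` tends to `0` or `1 / x` is bounded and converges. -/
theorem tendsto_x_or (hV : IsPotential V) (hz : SolvesForward (phaseField V) z)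
    (h0 : z 0 ∈ phaseSet V xbar) : Tendsto (fun t => (z t).2.1) atTop (𝓝 0) ∨
      ∃ H, Tendsto (fun t => ((z t).2.1)⁻¹) atTop (𝓝 H) := by
  have tr := hz.isTrajectory hV h0
  have hmono : Monotone fun t => ((z (max 0 t)).2.1)⁻¹ := fun s t hst =>
    tr.monotoneOn_h (mem_Ici.2 (le_max_left _ _)) (mem_Ici.2 (le_max_left _ _))
      (max_le_max_left 0 hst)
  have heq : (fun t => ((z (max 0 t)).2.1)⁻¹) =ᶠ[atTop] fun t => ((z t).2.1)⁻¹ := by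
    filter_upwards [eventually_ge_atTop 0] with t ht
    rw [max_eq_right ht]
  rcases tendsto_atTop_of_monotone hmono with h | ⟨H, h⟩
  · left
    exact (h.congr' heq).inv_tendsto_atTop.congr fun t => by simp
  · exact Or.inr ⟨H, h.congr' heq⟩

/-- A solution starting with positive velocity whose velocity is never negative always has positive
velocity. -/
theorem velocity_pos (hV : IsPotential V) (hz : SolvesForward (phaseField V) z)
    (h0 : 0 < (z 0).2.2) (hw : ∀ t, 0 ≤ t → 0 ≤ (z t).2.2) {t : ℝ} (ht : 0 ≤ t) :
    0 < (z t).2.2 := by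
  refine (hw t ht).lt_of_ne fun hzero => ?_
  have htpos : 0 < t := ht.lt_of_ne (by rintro rfl; exact h0.ne hzero)
  have hmin : IsLocalMin (fun t => (z t).2.2) t := by
    filter_upwards [lt_mem_nhds htpos] with s hs
    rw [← hzero]
    exact hw s hs.le
  have hd := hmin.hasDerivAt_eq_zero (hz.components ht).2.2
  rw [← hzero] at hd
  -- A zero minimum of `w` at positive time has `w = w' = 0`, which makes the state an equilibrium.
  -- Backward uniqueness then contradicts the positive initial velocity.
  have hF : phaseField V (z t) = 0 := by
    simp only [phaseField, ← hzero, hd]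
    simp
  have hrev := (hz.solvesOn t).reverse
  have hconst : SolvesOn (fun p => -phaseField V p) t fun _ => z t := fun s _ => by
    simp only [hF, neg_zero]
    exact hasDerivWithinAt_const s _ (z t)
  have := hrev.eqOn hV.contDiff_phaseField.neg hconst (by simp) ⟨ht, le_rfl⟩
  simp only [sub_self] at this
  rw [this] at h0
  exact h0.ne hzero

end SolvesForward

/-! ### Density and openness of the data with `x → 0` -/

/-- The reflection `(φ, x, w) ↦ (-φ, x, -w)`. -/
def phaseReflect (p : ℝ × ℝ × ℝ) : ℝ × ℝ × ℝ := (-p.1, p.2.1, -p.2.2)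

theorem phaseReflect_phaseReflect (p : ℝ × ℝ × ℝ) : phaseReflect (phaseReflect p) = p := by
  simp [phaseReflect]

theorem dist_phaseReflect (p q : ℝ × ℝ × ℝ) : dist (phaseReflect p) (phaseReflect q) = dist p q := by
  simp [phaseReflect, Prod.dist_eq]

theorem phaseReflect_mem {V : ℝ → ℝ} {xbar : ℝ} {p : ℝ × ℝ × ℝ} (hp : p ∈ phaseSet V xbar) :
    phaseReflect p ∈ phaseSet (fun s => V (-s)) xbar := by
  simpa [phaseSet, phaseReflect] using hp

theorem SolvesForward.phaseReflect {V : ℝ → ℝ} {z : ℝ → ℝ × ℝ × ℝ}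
    (hz : SolvesForward (phaseField V) z) :
    SolvesForward (phaseField fun s => V (-s)) fun t => phaseReflect (z t) := by
  intro t ht
  obtain ⟨h1, h2, h3⟩ := hz.components ht
  refine (h1.neg.prodMk (h2.prodMk h3.neg)).congr_deriv ?_
  simp only [phaseField, _root_.phaseReflect, deriv_comp_neg, neg_neg, Prod.mk.injEq, true_and]
  constructor <;> ring

namespace IsPotential

variable {V : ℝ → ℝ} {xbar : ℝ}

/-- Initial data near `p` cannot all lead to solutions with bounded `1 / x` and `w ≥ 0` from a
certain time on. -/
theorem not_all_near_nonneg (hV : IsPotential V) {p : ℝ × ℝ × ℝ} (hp : p ∈ phaseSet V xbar)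
    (hpx : p.2.1 < xbar) {T ε : ℝ} (hT : 0 ≤ T) (hε : 0 < ε)
    (hyp : ∀ y, SolvesForward (phaseField V) y → y 0 ∈ phaseSet V xbar → dist (y 0) p < ε →
      (∃ H, Tendsto (fun t => ((y t).2.1)⁻¹) atTop (𝓝 H)) ∧ ∀ t ≥ T, 0 ≤ (y t).2.2) : False := by
  obtain ⟨z, rfl, hz, hzmem⟩ := hV.exists_forward hp
  obtain ⟨δ, hδ, hback⟩ := hV.backward_near hz ⟨hp.1.1, hpx⟩ hT hε
  have hq := hzmem T hT
  have hwT := (hyp z hz hp (by simpa using hε)).2 T le_rfl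
  generalize z T = q at hback hq hwT
  obtain ⟨φ₀, x₀, w₀⟩ := q
  obtain ⟨⟨hx₀, hx₀'⟩, hcon⟩ := hq
  dsimp only at hx₀ hx₀' hcon hwT
  have hcont : ContinuousAt (fun x : ℝ => (φ₀, x, √(1 - V φ₀ * x ^ 2))) x₀ := by fun_prop
  have hval : ((φ₀, x₀, √(1 - V φ₀ * x₀ ^ 2)) : ℝ × ℝ × ℝ) = (φ₀, x₀, w₀) := by
    rw [← hcon, add_sub_cancel_left, Real.sqrt_sq hwT]
  obtain ⟨η, hη, hηball⟩ := Metric.continuousAt_iff.1 hcont δ hδ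
  rw [hval] at hηball
  -- For `x ∈ (x₁, x₀)` the point `(φ₀, x, √(1 - V φ₀ x²))` is within `δ` of the time `T` state,
  -- hence reached from data near `p`. Lowering `x` makes its velocity strictly positive, so `k =
  -- 1/x` parametrises the family to be contradicted.
  set x₁ := max (x₀ - η) (x₀ / 2)
  have hx₁pos : 0 < x₁ := lt_max_of_lt_right (by positivity)
  have hx₁lt : x₁ < x₀ := max_lt (by linarith) (by linarith)
  refine hV.not_forall_bounded (φ₀ := φ₀) (inv_pos.2 hx₀) (inv_strictAnti₀ hx₁pos hx₁lt)
    fun k hk => ?_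
  have hkpos : 0 < k := (inv_pos.2 hx₀).trans hk.1
  have hk1 : k⁻¹ < x₀ := inv_lt_of_inv_lt₀ hx₀ hk.1
  have hk2 : x₁ < k⁻¹ := (lt_inv_comm₀ hkpos hx₁pos).1 hk.2
  have hkinv : 0 < k⁻¹ := inv_pos.2 hkpos
  have hpos : 0 < 1 - V φ₀ * k⁻¹ ^ 2 := by
    rcases le_or_gt (V φ₀) 0 with h | h
    · nlinarith [mul_nonneg (neg_nonneg.2 h) (sq_nonneg k⁻¹)]
    · have : V φ₀ * k⁻¹ ^ 2 < V φ₀ * x₀ ^ 2 := by gcongr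
      nlinarith [sq_nonneg w₀]
  obtain ⟨y, hy0, hy, hyd, hyT⟩ := hback (φ₀, k⁻¹, √(1 - V φ₀ * k⁻¹ ^ 2))
    ⟨⟨hkinv, hk1.le.trans hx₀'⟩, by dsimp only; rw [Real.sq_sqrt hpos.le]; ring⟩ (hηball (by
      rw [Real.dist_eq, abs_lt]
      constructor <;> linarith [le_max_left (x₀ - η) (x₀ / 2)]))
  obtain ⟨⟨H, hH⟩, hyw⟩ := hyp y hy hy0 hyd
  have hys := hy.shift hT
  have hmem : y (0 + T) ∈ phaseSet V xbar := hy.mem_phaseSet hV hy0 (by simpa using hT)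
  refine ⟨_, _, _, H, hys.isTrajectory hV hmem, ?_, ?_, ?_, ?_⟩
  · simp [hyT]
  · simp [hyT]
  · intro t ht
    refine hys.velocity_pos hV ?_ (fun s hs => hyw _ (by linarith)) ht
    simp only [zero_add, hyT]
    exact Real.sqrt_pos.2 hpos
  · exact hH.comp (tendsto_atTop_add_const_right _ T tendsto_id)

/-- The same with a velocity of either constant sign. -/
theorem not_all_near_sign (hV : IsPotential V) {p : ℝ × ℝ × ℝ} (hp : p ∈ phaseSet V xbar)
    (hpx : p.2.1 < xbar) {T ε : ℝ} (hT : 0 ≤ T) (hε : 0 < ε) (σ : ℝ) (hσ : σ = 1 ∨ σ = -1)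
    (hyp : ∀ y, SolvesForward (phaseField V) y → y 0 ∈ phaseSet V xbar → dist (y 0) p < ε →
      (∃ H, Tendsto (fun t => ((y t).2.1)⁻¹) atTop (𝓝 H)) ∧ ∀ t ≥ T, 0 ≤ σ * (y t).2.2) :
    False := by
  rcases hσ with rfl | rfl
  · exact hV.not_all_near_nonneg hp hpx hT hε (by simpa using hyp)
  · refine hV.reflect.not_all_near_nonneg (phaseReflect_mem hp) hpx hT hε fun y hy hy0 hyd => ?_
    have h1 := hy.phaseReflect
    have h2 := phaseReflect_mem hy0
    simp only [neg_neg] at h1 h2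
    have := hyp _ h1 h2 (by rwa [← dist_phaseReflect, phaseReflect_phaseReflect])
    simpa [phaseReflect] using this

end IsPotential

/-- A nonempty open set of a Baire space that is covered by countably many of its relatively closed
subsets contains an interior point of one of them. -/
theorem exists_mem_nhds_of_cover {X ι : Type*} [TopologicalSpace X] [BaireSpace X] [Countable ι]
    {O : Set X} (hO : IsOpen O) (hne : O.Nonempty) {A : ι → Set X}
    (hA : ∀ i, IsOpen (O \ A i)) (hcov : O ⊆ ⋃ i, A i) : ∃ i, ∃ u ∈ O, A i ∈ 𝓝 u := by
  obtain ⟨u₀, hu₀⟩ := hne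
  obtain ⟨i₀, -⟩ := mem_iUnion.1 (hcov hu₀)
  -- The complements of `O \ A i` are closed and cover the whole space, not just `O`.
  have hdense := dense_iUnion_interior_of_closed (f := fun i => (O \ A i)ᶜ)
    (fun i => (hA i).isClosed_compl) ?_
  · obtain ⟨u, hu, hu'⟩ := hdense.inter_open_nonempty O hO ⟨u₀, hu₀⟩
    obtain ⟨i, hi⟩ := mem_iUnion.1 hu'
    refine ⟨i, u, hu, ?_⟩
    filter_upwards [isOpen_interior.mem_nhds hi, hO.mem_nhds hu] with v hv hv'
    by_contra hvA
    exact interior_subset hv ⟨hv', hvA⟩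
  · refine eq_univ_of_forall fun u => mem_iUnion.2 ?_
    by_cases hu : u ∈ O
    · obtain ⟨i, hi⟩ := mem_iUnion.1 (hcov hu)
      exact ⟨i, fun h => h.2 hi⟩
    · exact ⟨i₀, fun h => hu h.1⟩

namespace IsPotential

variable {V : ℝ → ℝ} {xbar : ℝ}

/-- Data for which `x` tends to `0` are dense. -/
theorem dense_tendsto_x (hV : IsPotential V) {p : ℝ × ℝ × ℝ} (hp : p ∈ phaseSet V xbar) {ε : ℝ}
    (hε : 0 < ε) : ∃ z, SolvesForward (phaseField V) z ∧ z 0 ∈ phaseSet V xbar ∧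
      dist (z 0) p < ε ∧ Tendsto (fun t => (z t).2.1) atTop (𝓝 0) := by
  by_contra! hcon
  have hbad : ∀ y, SolvesForward (phaseField V) y → y 0 ∈ phaseSet V xbar → dist (y 0) p < ε →
      ∃ H, Tendsto (fun t => ((y t).2.1)⁻¹) atTop (𝓝 H) := fun y hy h0 hd =>
    (hy.tendsto_x_or hV h0).resolve_left (hcon y hy h0 hd)
  choose! Z hZ0 hZ hZmem using fun q (hq : q ∈ phaseSet V xbar) => hV.exists_forward hq
  obtain ⟨φ₀, x₀, w₀⟩ := p
  obtain ⟨⟨hx₀, hx₀'⟩, hpc⟩ := hp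
  dsimp only at hx₀ hx₀' hpc
  obtain ⟨σ, hσ, hσw⟩ : ∃ σ : ℝ, (σ = 1 ∨ σ = -1) ∧ σ * |w₀| = w₀ := by
    rcases le_total 0 w₀ with h | h
    · exact ⟨1, Or.inl rfl, by rw [abs_of_nonneg h, one_mul]⟩
    · exact ⟨-1, Or.inr rfl, by rw [abs_of_nonpos h]; ring⟩
  have hσ2 : σ ^ 2 = 1 := by rcases hσ with rfl | rfl <;> norm_num
  have hVc := hV.continuous
  -- `χ` parametrises by the plane the sheet of the constraint surface on which `w` has the sign `σ`
  -- of `w₀`; Baire's theorem is applied in the plane.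
  let χ : ℝ × ℝ → ℝ × ℝ × ℝ := fun u => (u.1, u.2, σ * √(1 - V u.1 * u.2 ^ 2))
  have hχ : Continuous χ := by
    have : Continuous fun u : ℝ × ℝ => V u.1 := hVc.comp continuous_fst
    fun_prop
  have hχp : χ (φ₀, x₀) = (φ₀, x₀, w₀) := by
    simp only [χ]
    rw [← hpc, add_sub_cancel_left, Real.sqrt_sq_eq_abs, hσw]
  let O : Set (ℝ × ℝ) := {u | dist (χ u) (φ₀, x₀, w₀) < ε ∧ 0 < u.2 ∧ u.2 < xbar ∧
    V u.1 * u.2 ^ 2 < 1}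
  have hO : IsOpen O := by
    have : Continuous fun u : ℝ × ℝ => V u.1 := hVc.comp continuous_fst
    have h1 : IsOpen {u | dist (χ u) (φ₀, x₀, w₀) < ε} := isOpen_lt (by fun_prop) (by fun_prop)
    have h2 : IsOpen {u : ℝ × ℝ | 0 < u.2} := isOpen_lt (by fun_prop) (by fun_prop)
    have h3 : IsOpen {u : ℝ × ℝ | u.2 < xbar} := isOpen_lt (by fun_prop) (by fun_prop)
    have h4 : IsOpen {u : ℝ × ℝ | V u.1 * u.2 ^ 2 < 1} := isOpen_lt (by fun_prop) (by fun_prop)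
    exact h1.inter (h2.inter (h3.inter h4))
  -- The centre itself may have `w₀ = 0` or `x₀ = xbar`. Lowering `x` slightly makes both
  -- inequalities strict.
  have hOne : O.Nonempty := by
    have h1 : Tendsto (fun x => χ (φ₀, x)) (𝓝[<] x₀) (𝓝 (φ₀, x₀, w₀)) := by
      rw [← hχp]
      exact ((hχ.comp (by fun_prop : Continuous fun x => (φ₀, x))).tendsto x₀).mono_left
        nhdsWithin_le_nhds
    obtain ⟨x, hx1, hx2⟩ := ((h1.eventually (Metric.ball_mem_nhds _ hε)).and
      (Ioo_mem_nhdsLT hx₀)).exists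
    refine ⟨(φ₀, x), hx1, hx2.1, hx2.2.trans_le hx₀', ?_⟩
    have hx20 := hx2.1
    rcases le_or_gt (V φ₀) 0 with h | h
    · nlinarith [mul_nonneg (neg_nonneg.2 h) (sq_nonneg x)]
    · have : V φ₀ * x ^ 2 < V φ₀ * x₀ ^ 2 := by
        gcongr
        exact hx2.2
      dsimp only
      nlinarith [sq_nonneg w₀]
  have hχmem : ∀ u ∈ O, χ u ∈ phaseSet V xbar := by
    rintro ⟨φ, x⟩ ⟨-, h1, h2, h3⟩
    refine ⟨⟨h1, h2.le⟩, ?_⟩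
    simp only [χ] at h3 ⊢
    rw [mul_pow, hσ2, Real.sq_sqrt (by linarith)]
    ring
  let s : Bool → ℝ := fun b => if b then 1 else -1
  -- Data whose velocity keeps the sign `s b` from time `n` on: relatively closed by continuous
  -- dependence, and a cover of `O` by `IsTrajectory.eventually_sign`. This sign is independent of
  -- the sign `σ` of the initial velocity.
  let A : ℕ × Bool → Set (ℝ × ℝ) := fun i =>
    {u | ∀ t : ℝ, (i.1 : ℝ) ≤ t → 0 ≤ s i.2 * (Z (χ u) t).2.2}
  have hA : ∀ i, IsOpen (O \ A i) := by
    rintro ⟨n, b⟩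
    rw [Metric.isOpen_iff]
    rintro u ⟨huO, huA⟩
    simp only [A, mem_ofPred_eq, not_forall, not_le] at huA
    obtain ⟨t, ht, hneg⟩ := huA
    have ht0 : 0 ≤ t := n.cast_nonneg.trans ht
    have hnear : ∀ᶠ q in 𝓝 (Z (χ u) t), s b * q.2.2 < 0 := by
      have : Continuous fun q : ℝ × ℝ × ℝ => s b * q.2.2 := by fun_prop
      exact this.continuousAt.eventually (gt_mem_nhds hneg)
    obtain ⟨r, hr, hrball⟩ := Metric.eventually_nhds_iff.1 hnear
    obtain ⟨δ, hδ, hδball⟩ := hV.forward_near (hZ _ (hχmem u huO)) ht0 hr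
    rw [hZ0 _ (hχmem u huO)] at hδball
    obtain ⟨η, hη, hball⟩ := Metric.mem_nhds_iff.1
      (inter_mem (hχ.continuousAt.eventually (Metric.ball_mem_nhds _ hδ)) (hO.mem_nhds huO))
    refine ⟨η, hη, fun v hv => ⟨(hball hv).2, fun hvA => ?_⟩⟩
    have hvm := hχmem v (hball hv).2
    have h1 := hrball (hδball _ (hZ _ hvm) (by rw [hZ0 _ hvm]; exact (hball hv).1))
    exact absurd (hvA t ht) (not_le.2 h1)
  have hcov : O ⊆ ⋃ i, A i := by
    intro u huO
    have hm := hχmem u huO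
    have hZm : Z (χ u) 0 ∈ phaseSet V xbar := by rwa [hZ0 _ hm]
    obtain ⟨H, hH⟩ := hbad _ (hZ _ hm) hZm (by rw [hZ0 _ hm]; exact huO.1)
    rcases ((hZ _ hm).isTrajectory hV hZm).eventually_sign hH with h | h
    · obtain ⟨T, hT⟩ := eventually_atTop.1 h
      obtain ⟨n, hn⟩ := exists_nat_ge T
      exact mem_iUnion.2 ⟨(n, true), fun t ht => by simpa [s] using hT t (hn.trans ht)⟩
    · obtain ⟨T, hT⟩ := eventually_atTop.1 h
      obtain ⟨n, hn⟩ := exists_nat_ge T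
      exact mem_iUnion.2 ⟨(n, false), fun t ht => by simpa [s] using hT t (hn.trans ht)⟩
  obtain ⟨⟨n, b⟩, u, huO, hu⟩ := exists_mem_nhds_of_cover hO hOne hA hcov
  obtain ⟨η, hη, hball⟩ := Metric.mem_nhds_iff.1 (inter_mem hu (hO.mem_nhds huO))
  -- Strict positivity ensures that every point of `phaseSet` close to `χ u` lies on the same sheet,
  -- hence in the image of `χ`.
  have hwu : 0 < σ * (χ u).2.2 := by
    simp only [χ]
    rw [← mul_assoc, ← sq, hσ2, one_mul]
    exact Real.sqrt_pos.2 (by linarith [huO.2.2.2])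
  have hnear : ∀ᶠ q in 𝓝 (χ u), 0 < σ * q.2.2 := by
    have : Continuous fun q : ℝ × ℝ × ℝ => σ * q.2.2 := by fun_prop
    exact this.continuousAt.eventually (lt_mem_nhds hwu)
  obtain ⟨r, hr, hrball⟩ := Metric.eventually_nhds_iff.1 hnear
  refine hV.not_all_near_sign (hχmem u huO) huO.2.2.1 n.cast_nonneg (lt_min hη hr) (s b)
    (by cases b <;> simp [s]) fun y hy hy0 hyd => ?_
  have hyu : ((y 0).1, (y 0).2.1) ∈ Metric.ball u η := by
    rw [Metric.mem_ball, Prod.dist_eq]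
    have h1 := hyd.trans_le (min_le_left _ _)
    rw [Prod.dist_eq, Prod.dist_eq] at h1
    exact max_lt ((le_max_left _ _).trans_lt h1)
      (((le_max_left _ _).trans (le_max_right _ _)).trans_lt h1)
  have hw0 := hrball (hyd.trans_le (min_le_right _ _))
  have hχy : χ ((y 0).1, (y 0).2.1) = y 0 := by
    have h1 : 1 - V (y 0).1 * (y 0).2.1 ^ 2 = (σ * (y 0).2.2) ^ 2 := by
      rw [mul_pow, hσ2, one_mul]
      linarith [hy0.2]
    simp only [χ]
    rw [h1, Real.sqrt_sq hw0.le, ← mul_assoc, ← sq, hσ2, one_mul]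
  obtain ⟨h1, h2⟩ := hball hyu
  have heq : EqOn (Z (y 0)) y (Ici 0) :=
    (hZ _ hy0).eqOn hV hy (hZ0 _ hy0)
  refine ⟨hbad y hy hy0 (by simpa [hχy] using h2.1), fun t ht => ?_⟩
  have := h1 t ht
  rw [hχy] at this
  rwa [← heq (n.cast_nonneg.trans ht)]

/-- Data for which `x` tends to `0` form a relatively open set. -/
theorem open_tendsto_x (hV : IsPotential V) {z : ℝ → ℝ × ℝ × ℝ}
    (hz : SolvesForward (phaseField V) z) (hlim : Tendsto (fun t => (z t).2.1) atTop (𝓝 0)) :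
    ∃ δ > 0, ∀ y, SolvesForward (phaseField V) y → y 0 ∈ phaseSet V xbar →
      dist (y 0) (z 0) < δ → Tendsto (fun t => (y t).2.1) atTop (𝓝 0) := by
  obtain ⟨C, hC⟩ := hV.bddAbove_limitValues
  -- Once `x < c`, `h²` exceeds every element of `limitValues V` and, being nondecreasing, cannot
  -- converge to one. The `1` only keeps the root positive.
  set c := (√(max C 1))⁻¹
  have hc0 : 0 < c := by positivity
  obtain ⟨T, hT, hT0⟩ := ((hlim.eventually (gt_mem_nhds (half_pos hc0))).and
    (eventually_ge_atTop 0)).exists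
  obtain ⟨δ, hδ, h⟩ := hV.forward_near hz hT0 (half_pos hc0)
  refine ⟨δ, hδ, fun y hy hy0 hyd => (hy.tendsto_x_or hV hy0).resolve_right ?_⟩
  rintro ⟨H, hH⟩
  have tr := hy.isTrajectory hV hy0
  have h1 := h y hy hyd
  have h2 : |(y T).2.1 - (z T).2.1| < c / 2 :=
    (((le_max_left _ _).trans (le_max_right _ _)).trans_lt h1 :
      dist (y T).2.1 (z T).2.1 < c / 2)
  have h3 : (y T).2.1 < c := by linarith [(abs_lt.1 h2).2]
  have hyT := (hy.mem_phaseSet hV hy0 hT0).1.1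
  have h4 : √(max C 1) < ((y T).2.1)⁻¹ := (lt_inv_comm₀ (by positivity) hyT).2 h3
  have h5 := h4.trans_le (tr.h_le hH hT0)
  have h6 : max C 1 < H ^ 2 := (Real.sqrt_lt' ((Real.sqrt_nonneg _).trans_lt h5)).1 h5
  exact absurd (hC (tr.sq_mem_limitValues hV hH)) (not_le.2 ((le_max_left C 1).trans_lt h6))

end IsPotential

/-! ### Passage between `s` and `φ` -/

namespace IsCompactification

variable {f : ℝ → ℝ}

theorem strictMono (hf : IsCompactification f) : StrictMono f := strictMono_of_deriv_pos hf.deriv_pos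

theorem continuous (hf : IsCompactification f) : Continuous f := hf.contDiff.continuous

theorem hasDerivAt (hf : IsCompactification f) (φ : ℝ) : HasDerivAt f (deriv f φ) φ :=
  (hf.contDiff.differentiable two_ne_zero φ).hasDerivAt

theorem mem_Ioo (hf : IsCompactification f) (φ : ℝ) : f φ ∈ Ioo (-1 : ℝ) 1 :=
  hf.range_eq ▸ mem_range_self φ

theorem fieldOf_apply (hf : IsCompactification f) (φ : ℝ) : fieldOf f (f φ) = φ :=
  Function.leftInverse_invFun hf.strictMono.injective φ

theorem apply_fieldOf (hf : IsCompactification f) {s : ℝ} (hs : s ∈ Ioo (-1 : ℝ) 1) :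
    f (fieldOf f s) = s := by
  rw [← hf.range_eq] at hs
  exact Function.invFun_eq hs

theorem hasDerivAt_fieldOf (hf : IsCompactification f) {s : ℝ} (hs : s ∈ Ioo (-1 : ℝ) 1) :
    HasDerivAt (fieldOf f) (deriv f (fieldOf f s))⁻¹ s := by
  have := hf.strictMono.hasDerivAt_invFun hf.continuous (hf.hasDerivAt (fieldOf f s))
    (hf.deriv_pos _).ne'
  rwa [hf.apply_fieldOf hs] at this

theorem slopeExt_eq {s : ℝ} (hs : s ∈ Ioo (-1 : ℝ) 1) : slopeExt f s = deriv f (fieldOf f s) :=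
  if_pos hs

theorem tendsto_atTop (hf : IsCompactification f) : Tendsto f atTop (𝓝[<] 1) := by
  refine tendsto_nhdsWithin_iff.2 ⟨tendsto_atTop_isLUB hf.strictMono.monotone ?_,
    Eventually.of_forall fun φ => (hf.mem_Ioo φ).2⟩
  rw [hf.range_eq]
  exact isLUB_Ioo (by norm_num)

theorem tendsto_atBot (hf : IsCompactification f) : Tendsto f atBot (𝓝[>] (-1)) := by
  refine tendsto_nhdsWithin_iff.2 ⟨tendsto_atBot_isGLB hf.strictMono.monotone ?_,
    Eventually.of_forall fun φ => (hf.mem_Ioo φ).1⟩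
  rw [hf.range_eq]
  exact isGLB_Ioo (by norm_num)

end IsCompactification

/-- The finite limits of `u` at `s = ±1` become the bound `|V'| ≤ K V` near `φ = ±∞`. -/
theorem AdmissiblePotential.isPotential {V f : ℝ → ℝ} (hV : AdmissiblePotential V f)
    (hf : IsCompactification f) : IsPotential V where
  contDiff := hV.contDiff
  bot := hV.pos_bot.and hV.deriv_neg_bot
  top := hV.pos_top.and hV.deriv_pos_top
  slope := by
    have key : ∀ (L : Filter ℝ) (l : ℝ), Tendsto (fun φ => logSlope V f (f φ)) L (𝓝 l) →
        (∀ᶠ φ in L, 0 < V φ) → ∀ᶠ φ in L, |deriv V φ| ≤ (|l| + 1) * √6 * V φ := by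
      intro L l hl hpos
      filter_upwards [hl.abs.eventually (gt_mem_nhds (lt_add_one |l|)), hpos] with φ h1 h2
      rw [logSlope, hf.fieldOf_apply, abs_div, abs_of_pos (by positivity : 0 < √6 * V φ),
        div_lt_iff₀ (by positivity)] at h1
      linarith
    obtain ⟨l, hl⟩ := hV.limit_left
    obtain ⟨r, hr⟩ := hV.limit_right
    refine ⟨(|l| + |r| + 1) * √6, eventually_sup.2 ⟨?_, ?_⟩⟩
    · filter_upwards [key atBot l (hl.comp hf.tendsto_atBot) hV.pos_bot, hV.pos_bot] with φ h1 h2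
      refine h1.trans ?_
      gcongr
      linarith [abs_nonneg r]
    · filter_upwards [key atTop r (hr.comp hf.tendsto_atTop) hV.pos_top, hV.pos_top] with φ h1 h2
      refine h1.trans ?_
      gcongr
      linarith [abs_nonneg l]

/-- Passage from `(s, x, w)` to the phase coordinates `(φ, x, w)`. -/
noncomputable def toPhase (f : ℝ → ℝ) (p : ℝ × ℝ × ℝ) : ℝ × ℝ × ℝ := (fieldOf f p.1, p.2)

/-- Passage from the phase coordinates `(φ, x, w)` to `(s, x, w)`. -/
def toFlat (f : ℝ → ℝ) (p : ℝ × ℝ × ℝ) : ℝ × ℝ × ℝ := (f p.1, p.2)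

theorem toFlat_toPhase {f : ℝ → ℝ} (hf : IsCompactification f) {p : ℝ × ℝ × ℝ}
    (hp : p.1 ∈ Ioo (-1 : ℝ) 1) : toFlat f (toPhase f p) = p := by
  simp [toFlat, toPhase, hf.apply_fieldOf hp]

theorem toPhase_toFlat {f : ℝ → ℝ} (hf : IsCompactification f) (p : ℝ × ℝ × ℝ) :
    toPhase f (toFlat f p) = p := by
  simp [toFlat, toPhase, hf.fieldOf_apply]

theorem mem_Omega_iff {V f : ℝ → ℝ} {xbar : ℝ} {p : ℝ × ℝ × ℝ} :
    p ∈ Omega V f xbar ↔ p.1 ∈ Ioo (-1 : ℝ) 1 ∧ toPhase f p ∈ phaseSet V xbar := Iff.rfl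

theorem toFlat_mem_Omega {V f : ℝ → ℝ} (hf : IsCompactification f) {xbar : ℝ} {p : ℝ × ℝ × ℝ}
    (hp : p ∈ phaseSet V xbar) : toFlat f p ∈ Omega V f xbar :=
  mem_Omega_iff.2 ⟨hf.mem_Ioo _, by rwa [toPhase_toFlat hf]⟩

/-- The third component of the flat field, inside the domain. -/
theorem flatField_velocity {V f ψ : ℝ → ℝ} {p : ℝ × ℝ × ℝ} (hp : p.1 ∈ Ioo (-1 : ℝ) 1) :
    (flatField V f ψ p).2.2 = √(3 / 2) * p.2.2 * (1 - p.2.2 ^ 2)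
      - (1 - ψ p.1) * (deriv V (fieldOf f p.1) / V (fieldOf f p.1) / 2) * (1 - p.2.2 ^ 2)
      - ψ p.1 * (1 / 2 * deriv V (fieldOf f p.1) * p.2.1 ^ 2) := by
  have hsqrt : √(3 / 2) = √6 / 2 := by
    rw [show (3 / 2 : ℝ) = 6 / 2 ^ 2 by norm_num, Real.sqrt_div (by norm_num),
      Real.sqrt_sq (by norm_num)]
  have hu : √(3 / 2) * logSlopeExt V f p.1 =
      deriv V (fieldOf f p.1) / V (fieldOf f p.1) / 2 := by
    rw [logSlopeExt, if_pos hp, logSlope, hsqrt]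
    have : √6 ≠ 0 := by positivity
    rw [div_mul_div_comm, mul_comm (2 : ℝ), mul_assoc √6, mul_div_mul_left _ _ this, div_div]
  simp only [flatField, theta1, theta2]
  rw [← hu]
  ring

theorem IsCutoff.eq_one_or {V f ψ : ℝ → ℝ} {δ : ℝ} (hψ : IsCutoff V f δ ψ) {s : ℝ}
    (hs : s ∈ Ioo (-1 : ℝ) 1) : ψ s = 1 ∨ 1 - δ ≤ |s| ∧ 0 < V (fieldOf f s) := by
  rcases le_total |s| (1 - δ) with h | h
  · exact Or.inl (hψ.eq_one s (Ioo_subset_Icc_self hs) h)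
  · exact Or.inr ⟨h, hψ.potential_pos s hs h⟩

/-- On the constraint set the flat field is the phase field in other coordinates. -/
theorem flatField_of_constraint {V f ψ : ℝ → ℝ} {δ : ℝ} (hψ : IsCutoff V f δ ψ) {p : ℝ × ℝ × ℝ}
    (hp : p.1 ∈ Ioo (-1 : ℝ) 1) (hc : V (fieldOf f p.1) * p.2.1 ^ 2 + p.2.2 ^ 2 = 1) :
    flatField V f ψ p =
      (deriv f (fieldOf f p.1) * p.2.2, (phaseField V (toPhase f p)).2) := by
  have h3 : (flatField V f ψ p).2.2 = (phaseField V (toPhase f p)).2.2 := by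
    rw [flatField_velocity hp]
    simp only [phaseField, toPhase]
    -- Either only `θ₂` is present, or `V > 0` and substituting `1 - w² = V x²` turns `θ₁` into
    -- `θ₂`.
    rcases hψ.eq_one_or hp with h | ⟨-, h⟩
    · rw [h]; ring
    · have : 1 - p.2.2 ^ 2 = V (fieldOf f p.1) * p.2.1 ^ 2 := by linarith
      rw [this]
      field_simp
      ring
  refine Prod.ext ?_ (Prod.ext rfl h3)
  simp [flatField, IsCompactification.slopeExt_eq hp]

theorem IsFlatCollapse.mono {V f ψ : ℝ → ℝ} {I J : Set ℝ} {γ : ℝ → ℝ × ℝ × ℝ}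
    (h : IsFlatCollapse V f ψ I γ) (hJ : J ⊆ I) : IsFlatCollapse V f ψ J γ :=
  ⟨fun τ hτ => ⟨(h.solution τ (hJ hτ)).1, (h.solution τ (hJ hτ)).2.mono hJ⟩, h.init_mem, h.init_pos,
    h.init_constraint⟩

section FlatToPhase

variable {V f ψ : ℝ → ℝ} {δ T : ℝ} {γ : ℝ → ℝ × ℝ × ℝ}

theorem IsFlatSolution.components {I : Set ℝ} (h : IsFlatSolution V f ψ I γ) {t : ℝ} (ht : t ∈ I) :
    HasDerivWithinAt (fun t => (γ t).1) (slopeExt f (γ t).1 * (γ t).2.2) I t ∧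
      HasDerivWithinAt (fun t => (γ t).2.1) (-√(3 / 2) * (γ t).2.1 * (γ t).2.2 ^ 2) I t ∧
      HasDerivWithinAt (fun t => (γ t).2.2) (flatField V f ψ (γ t)).2.2 I t :=
  hasDerivWithinAt_triple_iff.1 (h t ht).2

theorem IsFlatSolution.hasDerivWithinAt_field (hf : IsCompactification f) {I : Set ℝ}
    (h : IsFlatSolution V f ψ I γ) {t : ℝ} (ht : t ∈ I) (hs : (γ t).1 ∈ Ioo (-1 : ℝ) 1) :
    HasDerivWithinAt (fun t => fieldOf f (γ t).1) (γ t).2.2 I t := by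
  refine ((hf.hasDerivAt_fieldOf hs).comp_hasDerivWithinAt t (h.components ht).1).congr_deriv ?_
  rw [IsCompactification.slopeExt_eq hs, inv_mul_cancel_left₀ (hf.deriv_pos _).ne']

/-- The boundary `s = ±1` is not reached in finite time. -/
theorem IsFlatSolution.mem_Ioo (hf : IsCompactification f)
    (h : IsFlatSolution V f ψ (Icc 0 T) γ) (h0 : (γ 0).1 ∈ Ioo (-1 : ℝ) 1) :
    ∀ t ∈ Icc 0 T, (γ t).1 ∈ Ioo (-1 : ℝ) 1 := by
  have hsc : ContinuousOn (fun t => (γ t).1) (Icc 0 T) := fun t ht =>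
    (h.components ht).1.continuousWithinAt
  have hwc : ContinuousOn (fun t => (γ t).2.2) (Icc 0 T) := fun t ht =>
    (h.components ht).2.2.continuousWithinAt
  obtain ⟨M, hM⟩ := isCompact_Icc.exists_bound_of_continuousOn hwc
  by_contra! hcon
  obtain ⟨t₁, ht₁, hout⟩ := hcon
  have hclosed : IsClosed {t ∈ Icc 0 T | (γ t).1 ∈ (Ioo (-1 : ℝ) 1)ᶜ} :=
    hsc.preimage_isClosed_of_isClosed isClosed_Icc isOpen_Ioo.isClosed_compl
  obtain ⟨m, ⟨hm, hmout⟩, hmin⟩ := (isCompact_Icc.of_isClosed_subset hclosed fun t ht =>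
    ht.1).exists_isLeast ⟨t₁, ht₁, hout⟩
  have hm0 : 0 < m := hm.1.lt_of_ne (by rintro rfl; exact hmout h0)
  have hM0 : 0 ≤ M := (norm_nonneg _).trans (hM m hm)
  have hin : ∀ t ∈ Ico 0 m, (γ t).1 ∈ Ioo (-1 : ℝ) 1 := fun t ht => by
    by_contra hnot
    exact absurd (hmin ⟨⟨ht.1, ht.2.le.trans hm.2⟩, hnot⟩) (not_le.2 ht.2)
  -- Before the first exit time `m`, `φ` has speed at most `M`, so `s` stays in a compact
  -- subinterval of `(-1, 1)`, and so does its value at `m`.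
  set φ₀ := fieldOf f (γ 0).1 with hφ₀
  have hbound : ∀ t ∈ Ico 0 m, (γ t).1 ∈ Icc (f (φ₀ - M * m)) (f (φ₀ + M * m)) := by
    intro t ht
    have hsub : Icc 0 t ⊆ Icc 0 T := Icc_subset_Icc_right (ht.2.le.trans hm.2)
    have := (convex_Icc 0 t).norm_image_sub_le_of_norm_hasDerivWithin_le
      (f := fun t => fieldOf f (γ t).1) (C := M)
      (fun r hr => (h.hasDerivWithinAt_field hf (hsub hr)
        (hin r ⟨hr.1, hr.2.trans_lt ht.2⟩)).mono hsub)
      (fun r hr => hM r (hsub hr)) ⟨le_rfl, ht.1⟩ ⟨ht.1, le_rfl⟩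
    rw [Real.norm_eq_abs, Real.norm_eq_abs, sub_zero, abs_of_nonneg ht.1, ← hφ₀] at this
    have h1 : M * t ≤ M * m := by gcongr; exact ht.2.le
    rw [← hf.apply_fieldOf (hin t ht)]
    exact ⟨hf.strictMono.monotone (by linarith [(abs_le.1 this).1]),
      hf.strictMono.monotone (by linarith [(abs_le.1 this).2])⟩
  have hlim : (γ m).1 ∈ Icc (f (φ₀ - M * m)) (f (φ₀ + M * m)) := by
    have h1 : Tendsto (fun t => (γ t).1) (𝓝[Ico 0 m] m) (𝓝 (γ m).1) :=
      (hsc m hm).mono (Ico_subset_Icc_self.trans (Icc_subset_Icc_right hm.2))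
    have : (𝓝[Ico 0 m] m).NeBot := by
      rw [← mem_closure_iff_nhdsWithin_neBot, closure_Ico hm0.ne]
      exact ⟨hm0.le, le_rfl⟩
    exact isClosed_Icc.mem_of_tendsto h1 (eventually_mem_nhdsWithin.mono hbound)
  exact hmout ⟨(hf.mem_Ioo _).1.trans_le hlim.1, hlim.2.trans_lt (hf.mem_Ioo _).2⟩

theorem IsFlatCollapse.mem_Ioo (hf : IsCompactification f)
    (h : IsFlatCollapse V f ψ (Icc 0 T) γ) : ∀ t ∈ Icc 0 T, (γ t).1 ∈ Ioo (-1 : ℝ) 1 :=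
  h.solution.mem_Ioo hf h.init_mem

/-- The constraint is preserved by the flat system. -/
theorem IsFlatCollapse.constraint (hf : IsCompactification f) (hV : IsPotential V)
    (hψ : IsCutoff V f δ ψ) (h : IsFlatCollapse V f ψ (Icc 0 T) γ) :
    ∀ t ∈ Icc 0 T, V (fieldOf f (γ t).1) * (γ t).2.1 ^ 2 + (γ t).2.2 ^ 2 = 1 := by
  have hin := h.mem_Ioo hf
  have hφc : ContinuousOn (fun t => fieldOf f (γ t).1) (Icc 0 T) := fun t ht =>
    (h.solution.hasDerivWithinAt_field hf ht (hin t ht)).continuousWithinAt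
  have hwc : ContinuousOn (fun t => (γ t).2.2) (Icc 0 T) := fun t ht =>
    (h.solution.components ht).2.2.continuousWithinAt
  obtain ⟨M, hM⟩ := isCompact_Icc.exists_bound_of_continuousOn hwc
  -- Off the constraint surface the cut-off still matters: the defect satisfies a linear equation
  -- whose coefficient contains `(1 - ψ) V'/V`. As `V` may vanish elsewhere, the quotient is bounded
  -- only over the visited `φ` with `|f φ| ≥ 1 - δ`; outside that set `ψ = 1`.
  have hKcpt : IsCompact ((fun t => fieldOf f (γ t).1) '' Icc 0 T ∩ {φ | 1 - δ ≤ |f φ|}) :=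
    (isCompact_Icc.image_of_continuousOn hφc).inter_right
      (isClosed_le continuous_const hf.continuous.abs)
  obtain ⟨B, hB⟩ := hKcpt.exists_bound_of_continuousOn (f := fun φ => deriv V φ / V φ)
    (hV.contDiff_deriv.continuous.continuousOn.div hV.continuous.continuousOn (by
      rintro φ ⟨-, hφ⟩
      have := hψ.potential_pos (f φ) (hf.mem_Ioo φ) hφ
      rw [hf.fieldOf_apply] at this
      exact this.ne'))
  set a : ℝ → ℝ := fun t => (1 - ψ (γ t).1) * (deriv V (fieldOf f (γ t).1) /
    V (fieldOf f (γ t).1)) * (γ t).2.2 - 2 * √(3 / 2) * (γ t).2.2 ^ 2 with ha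
  have hbound : ∀ t ∈ Icc 0 T, |a t| ≤ |B| * M + 2 * √(3 / 2) * M ^ 2 := by
    intro t ht
    have hwM : |(γ t).2.2| ≤ M := hM t ht
    have h1 : |(1 - ψ (γ t).1) * (deriv V (fieldOf f (γ t).1) / V (fieldOf f (γ t).1))| ≤ |B| := by
      rcases hψ.eq_one_or (hin t ht) with hone | ⟨hδ, -⟩
      · rw [hone, sub_self, zero_mul, abs_zero]
        exact abs_nonneg B
      · have h2 := hB (fieldOf f (γ t).1) ⟨⟨t, ht, rfl⟩, by
          simpa [hf.apply_fieldOf (hin t ht)] using hδ⟩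
        have h3 := hψ.mem_Icc _ (Ioo_subset_Icc_self (hin t ht))
        rw [abs_mul, abs_of_nonneg (sub_nonneg.2 h3.2)]
        exact (mul_le_of_le_one_left (abs_nonneg _) (by linarith [h3.1])).trans
          (h2.trans (le_abs_self B))
    refine (abs_sub _ _).trans (add_le_add ?_ ?_)
    · rw [abs_mul]
      gcongr
    · rw [abs_mul, abs_of_nonneg (by positivity), abs_pow]
      gcongr
  have hderiv : ∀ t ∈ Icc 0 T, HasDerivWithinAt
      (fun t => V (fieldOf f (γ t).1) * (γ t).2.1 ^ 2 + (γ t).2.2 ^ 2 - 1)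
      (a t * (V (fieldOf f (γ t).1) * (γ t).2.1 ^ 2 + (γ t).2.2 ^ 2 - 1)) (Icc 0 T) t := by
    intro t ht
    obtain ⟨-, h2, h3⟩ := h.solution.components ht
    have h1 := h.solution.hasDerivWithinAt_field hf ht (hin t ht)
    refine (((((hV.hasDerivAt _).comp_hasDerivWithinAt t h1).mul (h2.pow 2)).add
      (h3.pow 2)).sub_const 1).congr_deriv ?_
    rw [flatField_velocity (hin t ht)]
    simp only [Function.comp_apply, Pi.pow_apply, ha]
    push_cast
    rcases hψ.eq_one_or (hin t ht) with hone | ⟨-, hpos⟩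
    · rw [hone]; ring
    · field_simp
      ring
  intro t ht
  have h1 := (sq_bounds_of_linear hderiv hbound t ht).2
  simp only [h.init_constraint, sub_self, ne_eq, OfNat.ofNat_ne_zero, not_false_eq_true,
    zero_pow] at h1
  have h2 := nonpos_of_mul_nonpos_left h1 (Real.exp_pos _)
  exact sub_eq_zero.1 (pow_eq_zero_iff two_ne_zero |>.1 (le_antisymm h2 (sq_nonneg _)))

/-- A collapsing scalar field solves the system in phase coordinates. -/
theorem IsFlatCollapse.solvesOn (hf : IsCompactification f) (hV : IsPotential V)
    (hψ : IsCutoff V f δ ψ) (h : IsFlatCollapse V f ψ (Icc 0 T) γ) :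
    SolvesOn (phaseField V) T fun t => toPhase f (γ t) := by
  intro t ht
  have hin := h.mem_Ioo hf t ht
  obtain ⟨-, h2, h3⟩ := h.solution.components ht
  have hfield := flatField_of_constraint hψ hin (h.constraint hf hV hψ t ht)
  rw [hfield] at h3
  exact (h.solution.hasDerivWithinAt_field hf ht hin).prodMk (h2.prodMk h3)

end FlatToPhase

section PhaseToFlat

variable {V f ψ : ℝ → ℝ} {δ xbar : ℝ} {z : ℝ → ℝ × ℝ × ℝ}

/-- A forward solution in phase coordinates is a collapsing scalar field. -/
theorem SolvesForward.isFlatCollapse (hf : IsCompactification f) (hV : IsPotential V)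
    (hψ : IsCutoff V f δ ψ) (hz : SolvesForward (phaseField V) z) (h0 : z 0 ∈ phaseSet V xbar) :
    IsFlatCollapse V f ψ (Ici 0) fun t => toFlat f (z t) := by
  have hmem : ∀ t, 0 ≤ t → z t ∈ phaseSet V xbar := fun t ht => hz.mem_phaseSet hV h0 ht
  refine ⟨fun t ht => ⟨Ioo_subset_Icc_self (hf.mem_Ioo _), ?_⟩, hf.mem_Ioo _, h0.1.1, ?_⟩
  · obtain ⟨h1, h2, h3⟩ := hz.components ht
    have hc : V (fieldOf f (toFlat f (z t)).1) * (toFlat f (z t)).2.1 ^ 2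
        + (toFlat f (z t)).2.2 ^ 2 = 1 := by
      simpa [toFlat, hf.fieldOf_apply] using (hmem t ht).2
    rw [flatField_of_constraint hψ (hf.mem_Ioo _) hc, toPhase_toFlat hf]
    have h4 := (hf.hasDerivAt (z t).1).comp t h1
    simp only [toFlat, hf.fieldOf_apply]
    exact (h4.prodMk (h2.prodMk h3)).hasDerivWithinAt
  · simpa [toFlat, hf.fieldOf_apply] using h0.2

/-- Every collapsing scalar field is given by the solution in phase coordinates. -/
theorem IsFlatCollapse.eq_toFlat (hf : IsCompactification f) (hV : IsPotential V)
    (hψ : IsCutoff V f δ ψ) {T : ℝ} {γ : ℝ → ℝ × ℝ × ℝ} (h : IsFlatCollapse V f ψ (Icc 0 T) γ)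
    (hz : SolvesForward (phaseField V) z) (h0 : z 0 = toPhase f (γ 0)) :
    ∀ t ∈ Icc 0 T, γ t = toFlat f (z t) := by
  intro t ht
  rw [← toFlat_toPhase hf (h.mem_Ioo hf t ht)]
  congr 1
  exact (h.solvesOn hf hV hψ).eqOn hV.contDiff_phaseField (hz.solvesOn T) h0.symm ht

end PhaseToFlat

/-! ### Generic properties and approach to `M₀` -/

section Generic

variable {V f ψ : ℝ → ℝ} {δ xbar : ℝ} {z : ℝ → ℝ × ℝ × ℝ}

theorem continuousAt_toPhase {f : ℝ → ℝ} (hf : IsCompactification f) {p : ℝ × ℝ × ℝ}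
    (hp : p.1 ∈ Ioo (-1 : ℝ) 1) : ContinuousAt (toPhase f) p :=
  ((hf.hasDerivAt_fieldOf hp).continuousAt.comp continuousAt_fst).prodMk continuousAt_snd

theorem continuous_toFlat {f : ℝ → ℝ} (hf : IsCompactification f) : Continuous (toFlat f) :=
  (hf.continuous.comp continuous_fst).prodMk continuous_snd

/-- A property of initial data that is equivalent to the decay of `x` holds generically. -/
theorem genericallyIn_of_iff_tendsto (hf : IsCompactification f) (hV : IsPotential V)
    {P : ℝ × ℝ × ℝ → Prop}
    (hP : ∀ z, SolvesForward (phaseField V) z → z 0 ∈ phaseSet V xbar →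
      (P (toFlat f (z 0)) ↔ Tendsto (fun t => (z t).2.1) atTop (𝓝 0))) :
    GenericallyIn (Omega V f xbar) P := by
  have hsol : ∀ p ∈ Omega V f xbar, ∃ z, SolvesForward (phaseField V) z ∧ z 0 ∈ phaseSet V xbar ∧
      z 0 = toPhase f p ∧ toFlat f (z 0) = p := fun p hp => by
    obtain ⟨z, h0, hz, -⟩ := hV.exists_forward (mem_Omega_iff.1 hp).2
    exact ⟨z, hz, h0 ▸ (mem_Omega_iff.1 hp).2, h0, h0 ▸ toFlat_toPhase hf hp.1⟩
  refine ⟨⟨interior {p | p ∈ Omega V f xbar → P p}, isOpen_interior, ?_⟩, fun p hp => ?_⟩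
  · ext p
    refine ⟨fun ⟨hp, hPp⟩ => ⟨hp, ?_⟩, fun ⟨hp, hPp⟩ => ⟨hp, interior_subset hPp hp⟩⟩
    obtain ⟨z, hz, hz0, hzp, hzp'⟩ := hsol p hp
    obtain ⟨r, hr, hopen⟩ := hV.open_tendsto_x (xbar := xbar) hz
      ((hP z hz hz0).1 (by rwa [hzp']))
    have hnear := (continuousAt_toPhase hf hp.1).eventually (Metric.ball_mem_nhds _ hr)
    rw [mem_interior_iff_mem_nhds]
    filter_upwards [hnear] with q hq hqΩ
    obtain ⟨y, hy, hy0, hyq, hyq'⟩ := hsol q hqΩ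
    rw [← hyq']
    exact (hP y hy hy0).2 (hopen y hy hy0 (by rw [hyq, hzp]; exact hq))
  · rw [Metric.mem_closure_iff]
    intro ε hε
    have hcont := (continuous_toFlat hf).continuousAt (x := toPhase f p)
    rw [Metric.continuousAt_iff, toFlat_toPhase hf hp.1] at hcont
    obtain ⟨r, hr, hball⟩ := hcont ε hε
    obtain ⟨y, hy, hy0, hyd, hlim⟩ := hV.dense_tendsto_x (mem_Omega_iff.1 hp).2 hr
    exact ⟨toFlat f (y 0), ⟨toFlat_mem_Omega hf hy0, (hP y hy hy0).2 hlim⟩, by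
      rw [dist_comm]; exact hball hyd⟩

theorem MZero_subset (V f : ℝ → ℝ) (xbar : ℝ) :
    MZero V f xbar ⊆ closure (Omega V f xbar) \ Omega V f xbar :=
  fun _ hp => ⟨hp.1.1, fun h => h.2.1.1.ne' hp.2⟩

theorem Approaches.tendsto_x {γ : ℝ → ℝ × ℝ × ℝ} (h : Approaches γ (MZero V f xbar)) :
    Tendsto (fun t => (γ t).2.1) atTop (𝓝 0) := by
  rw [Metric.tendsto_atTop]
  intro ε hε
  obtain ⟨T, hT⟩ := h ε hε
  refine ⟨T, fun t ht => ?_⟩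
  obtain ⟨q, hq, hd⟩ := hT t ht
  have hq0 : q.2.1 = 0 := hq.2
  rw [← hq0]
  exact ((le_max_left _ _).trans (le_max_right _ _)).trans_lt hd

/-- A curve in `Ω` along which `x` tends to `0` approaches `M₀`. -/
theorem approaches_MZero (hf : IsCompactification f) (hV : IsPotential V)
    {γ : ℝ → ℝ × ℝ × ℝ} (hγ : ∀ t, 0 ≤ t → γ t ∈ Omega V f xbar)
    (hlim : Tendsto (fun t => (γ t).2.1) atTop (𝓝 0)) : Approaches γ (MZero V f xbar) := by
  obtain ⟨W, hW, hWb⟩ := hV.exists_velocity_bound xbar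
  by_contra hcon
  simp only [Approaches, not_forall, not_exists, not_and, not_lt] at hcon
  obtain ⟨ε, hε, hfar⟩ := hcon
  choose τ hτ hfar using hfar
  have hτtop : Tendsto (fun n : ℕ => τ (n : ℝ)) atTop atTop :=
    tendsto_atTop_mono (fun n => hτ n) tendsto_natCast_atTop_atTop
  have hτ0 : ∀ n : ℕ, 0 ≤ τ (n : ℝ) := fun n => n.cast_nonneg.trans (hτ n)
  have hcpt : IsCompact (Icc (-1 : ℝ) 1 ×ˢ Icc (0 : ℝ) xbar ×ˢ Icc (-W) W) :=
    isCompact_Icc.prod (isCompact_Icc.prod isCompact_Icc)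
  -- A sequence of times at which the curve stays `ε` away from `M₀` has an accumulation point in a
  -- compact box; that point turns out to lie in `M₀`.
  obtain ⟨q, hq, k, hk, hkq⟩ := hcpt.tendsto_subseq (x := fun n : ℕ => γ (τ (n : ℝ))) fun n => by
    have h := hγ _ (hτ0 n)
    exact ⟨Ioo_subset_Icc_self h.1, Ioc_subset_Icc_self h.2.1,
      abs_le.1 (hWb (toPhase f (γ (τ (n : ℝ)))) (mem_Omega_iff.1 h).2)⟩
  have hx : q.2.1 = 0 := by
    refine tendsto_nhds_unique ?_ (hlim.comp (hτtop.comp hk.tendsto_atTop))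
    exact ((continuous_fst.comp continuous_snd).tendsto q).comp hkq
  have hqcl : q ∈ closure (Omega V f xbar) :=
    mem_closure_of_tendsto hkq (Eventually.of_forall fun n => hγ _ (hτ0 _))
  have hqM : q ∈ MZero V f xbar := by
    refine ⟨⟨hqcl, ?_⟩, hx⟩
    -- For `|s| < 1` the function `V ∘ f⁻¹` is continuous at the limit, so the constraint passes to
    -- it and `x = 0` gives `w² = 1`.
    by_cases hs : q.1 ∈ Ioo (-1 : ℝ) 1
    · right
      have hc : ContinuousAt (fun p : ℝ × ℝ × ℝ => V (fieldOf f p.1) * p.2.1 ^ 2 + p.2.2 ^ 2) q := by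
        have h1 : ContinuousAt (fun p : ℝ × ℝ × ℝ => V (fieldOf f p.1)) q :=
          hV.continuous.continuousAt.comp
            ((hf.hasDerivAt_fieldOf hs).continuousAt.comp continuousAt_fst)
        have h2 : Continuous fun p : ℝ × ℝ × ℝ => p.2.1 ^ 2 := by fun_prop
        have h3 : Continuous fun p : ℝ × ℝ × ℝ => p.2.2 ^ 2 := by fun_prop
        exact (h1.mul h2.continuousAt).add h3.continuousAt
      have h2 := tendsto_nhds_unique (hc.tendsto.comp hkq)
        (tendsto_const_nhds.congr fun n => ((hγ _ (hτ0 (k n))).2.2).symm)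
      rw [hx] at h2
      have h3 : q.2.2 ^ 2 = 1 := by linarith
      exact (pow_eq_one_iff_of_nonneg (abs_nonneg _) two_ne_zero).1 (by rwa [sq_abs])
    · left
      have h1 := hq.1
      rcases h1.1.eq_or_lt with h | h
      · simp [← h]
      rcases h1.2.eq_or_lt with h' | h'
      · simp [h']
      · exact absurd ⟨h, h'⟩ hs
  obtain ⟨n, hn⟩ := ((Metric.tendsto_nhds.1 hkq) ε hε).exists
  exact absurd hn (not_lt.2 (hfar (k n : ℝ) q hqM))

end Generic

theorem mainTheorem1 (V f ψ : ℝ → ℝ) (δ xbar : ℝ)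
    (hf : IsCompactification f) (hV : AdmissiblePotential V f) (hψ : IsCutoff V f δ ψ)
    (hx : 0 < xbar) :
    (∀ T > 0, ∀ γ : ℝ → ℝ × ℝ × ℝ, IsFlatCollapse V f ψ (Ico 0 T) γ →
      γ 0 ∈ Omega V f xbar → ∀ τ ∈ Ico 0 T, γ τ ∈ Omega V f xbar) ∧
    (∀ p ∈ Omega V f xbar, ∃ γ : ℝ → ℝ × ℝ × ℝ,
      IsFlatCollapse V f ψ (Ici 0) γ ∧ γ 0 = p ∧ (∀ τ ≥ 0, γ τ ∈ Omega V f xbar) ∧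
      ∀ T > 0, ∀ η : ℝ → ℝ × ℝ × ℝ, IsFlatCollapse V f ψ (Ico 0 T) η → η 0 = p →
        EqOn η γ (Ico 0 T)) ∧
    MZero V f xbar ⊆ closure (Omega V f xbar) \ Omega V f xbar ∧
    GenericallyIn (Omega V f xbar) (fun p => ∀ γ : ℝ → ℝ × ℝ × ℝ,
      IsFlatCollapse V f ψ (Ici 0) γ → γ 0 = p → Approaches γ (MZero V f xbar)) ∧
    GenericallyIn (Omega V f xbar) (fun p => ∀ γ : ℝ → ℝ × ℝ × ℝ,
      IsFlatCollapse V f ψ (Ici 0) γ → γ 0 = p →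
        Tendsto (fun τ => (γ τ).2.1) atTop (𝓝[>] 0)) := by
  have hV' : IsPotential V := hV.isPotential hf
  -- By uniqueness the quantifier over all `γ` in both generic properties concerns a single curve on
  -- nonnegative times, so each property reduces to the decay of `x` along it.
  have hrec : ∀ z, SolvesForward (phaseField V) z → z 0 ∈ phaseSet V xbar → ∀ γ,
      IsFlatCollapse V f ψ (Ici 0) γ → γ 0 = toFlat f (z 0) → ∀ t, 0 ≤ t → γ t = toFlat f (z t) :=
    fun z hz _ γ hγ h0 t ht => (hγ.mono Icc_subset_Ici_self).eq_toFlat hf hV' hψ hz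
      (by rw [h0, toPhase_toFlat hf]) t ⟨ht, le_rfl⟩
  refine ⟨?_, ?_, MZero_subset V f xbar, genericallyIn_of_iff_tendsto hf hV' ?_,
    genericallyIn_of_iff_tendsto hf hV' ?_⟩
  · intro T _ γ hγ h0 τ hτ
    have hγ' : IsFlatCollapse V f ψ (Icc 0 τ) γ :=
      hγ.mono fun t ht => ⟨ht.1, ht.2.trans_lt hτ.2⟩
    have hττ : τ ∈ Icc 0 τ := ⟨hτ.1, le_rfl⟩
    exact mem_Omega_iff.2 ⟨hγ'.mem_Ioo hf τ hττ,
      (hγ'.solvesOn hf hV' hψ).mem_phaseSet hV' (mem_Omega_iff.1 h0).2 τ hττ⟩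
  · intro p hp
    obtain ⟨z, h0, hz, hmem⟩ := hV'.exists_forward (mem_Omega_iff.1 hp).2
    have hp' : toFlat f (z 0) = p := by rw [h0, toFlat_toPhase hf hp.1]
    refine ⟨fun t => toFlat f (z t), hz.isFlatCollapse hf hV' hψ (hmem 0 le_rfl), hp',
      fun τ hτ => toFlat_mem_Omega hf (hmem τ hτ), fun T _ η hη hη0 τ hτ => ?_⟩
    exact (hη.mono fun t ht => ⟨ht.1, ht.2.trans_lt hτ.2⟩ :
      IsFlatCollapse V f ψ (Icc 0 τ) η).eq_toFlat hf hV' hψ hz (by rw [h0, hη0]) τ ⟨hτ.1, le_rfl⟩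
  · intro z hz h0
    have hΩ : ∀ t, 0 ≤ t → toFlat f (z t) ∈ Omega V f xbar := fun t ht =>
      toFlat_mem_Omega hf (hz.mem_phaseSet hV' h0 ht)
    refine ⟨fun h => (h _ (hz.isFlatCollapse hf hV' hψ h0) rfl).tendsto_x, fun h γ hγ hγ0 => ?_⟩
    have heq := hrec z hz h0 γ hγ hγ0
    refine approaches_MZero hf hV' (fun t ht => by rw [heq t ht]; exact hΩ t ht) (h.congr' ?_)
    filter_upwards [eventually_ge_atTop 0] with t ht
    rw [heq t ht, toFlat]
  · intro z hz h0
    refine ⟨fun h => (h _ (hz.isFlatCollapse hf hV' hψ h0) rfl).mono_right nhdsWithin_le_nhds,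
      fun h γ hγ hγ0 => ?_⟩
    have heq := hrec z hz h0 γ hγ hγ0
    refine tendsto_nhdsWithin_iff.2 ⟨h.congr' ?_, ?_⟩ <;>
    filter_upwards [eventually_ge_atTop 0] with t ht <;> rw [heq t ht, toFlat]
    exact (hz.mem_phaseSet hV' h0 ht).1.1
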